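/- Let $A$ and $B$ be finite sets of points in the Euclidean plane $\mathbb{R}^2$ with $|A|=n\ge |B|=m\ge 1$. For an injective map $\pi:B\to A$ and a translation $t\in\mathbb{R}^2$ let $f(\pi,t)=\sum_{b\in B}\|b+t-\pi(b)\|^2$, and call $\pi$ optimal at $t$ if $f(\pi,t)\le f(\sigma,t)$ for every injective $\sigma:B\to A$. The partial-matching subdivision $\mathcal{D}_{B,A}$ is the partition of $\mathbb{R}^2$ in which $t_1$ and $t_2$ lie in the same face if and only if the set of assignments optimal at $t_1$ equals the set of assignments optimal at $t_2$; its faces of dimension $0$, $1$ and $2$ (dimension of the affine hull) are its vertices, edges and regions, and its combinatorial complexity is the total number of its vertices, edges and regions. Then $\mathcal{D}_{B,A}$ has finitely many faces, and its combinatorial complexity is $$O\bigl(n^2\, m^{3.5}\,(e\ln m+e)^m\bigr),$$ that is, at most $C\,n^2 m^{3.5}(e\ln m+e)^m$, where $C>0$ is an absolute constant, independent of $A$, $B$, $n$ and $m$. -/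

import Mathlib

/-- The Euclidean plane. -/
abbrev Plane : Type := EuclideanSpace ℝ (Fin 2)

namespace PartialMatching

/-- The cost `∑_{b ∈ B} ‖b + t - π(b)‖²` of an injective assignment `π : B ↪ A`
when the pattern `B` is translated by `t`. -/
noncomputable def cost (B A : Finset Plane) (π : B ↪ A) (t : Plane) : ℝ :=
  ∑ b : B, ‖(b : Plane) + t - (π b : Plane)‖ ^ 2

/-- The set of injective assignments that attain the minimum cost at the translation `t`. -/
def optimal (B A : Finset Plane) (t : Plane) : Set (B ↪ A) :=
  {π | ∀ σ : B ↪ A, cost B A π t ≤ cost B A σ t}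

/-- The faces, of all dimensions, of the partial-matching subdivision: the classes of translations
at which the minimum cost is attained by the same set of assignments. They are the relatively open
faces of the minimization diagram of the cost functions. -/
def faces (B A : Finset Plane) : Set (Set Plane) :=
  Set.range fun t : Plane => {s : Plane | optimal B A s = optimal B A t}

/-- The faces of dimension `k`. The dimension of a face is that of its affine hull. -/
def facesOfDim (B A : Finset Plane) (k : ℕ) : Set (Set Plane) :=
  {s ∈ faces B A | Module.finrank ℝ (vectorSpan ℝ s) = k}

/-- The combinatorial complexity of the partial-matching subdivision: its number of vertices,
plus its number of edges, plus its number of (two-dimensional) regions. -/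
noncomputable def complexity (B A : Finset Plane) : ℕ :=
  (facesOfDim B A 0).ncard + (facesOfDim B A 1).ncard + (facesOfDim B A 2).ncard

end PartialMatching

/-!
Up to the common summand `m ‖t‖²`, the cost of an assignment is an affine function of the
translation `t`, so the subdivision is the minimization diagram of finitely many affine functions on
the plane. A sweep by a horizontal line shows that such a diagram has at most six times as many
faces as regions (`card_faces_le`; the edges are counted in `card_adjacent_le`, the vertices in
`card_vertices_le`). It remains to count the regions.

The gradient of the cost depends only on the image of the assignment, so a region is determined by
the image of an assignment that is optimal in it (`costCoeff_eq_of_image_eq`). An optimal assignment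
`π` is saturated: each point of `A` that is closer to `b + t` than `π b` is in the image
(`saturated_of_minimal`). In particular `π b` is one of the `m` nearest neighbours of `b + t`, and
whether an assignment is saturated depends only on the ordered lists of these neighbours.

* For one preference profile, saturated matchings use at most `m H_m` points altogether
  (`card_reachable_le`). They are covered by the `m` matchings in which some `b` is worst off, and
  the images of these overlap: of two points that `b` gets in two of the matchings, the preferred one
  belongs to the images of both. So there are at most `choose (m H_m) m` images, which Stirling's
  formula bounds by `(e ln m + e)^m / √m`.
* The lists of the `m` nearest neighbours change only across bisectors of pairs that are tied with
  fewer than `m` points closer (`order_preserved`). By the sampling argument of Clarkson and Shor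
  there are `O(m n)` such pairs for each `b` (`exists_cover_lowTie`), hence `O(m² n)` lines in all,
  and by the Sauer–Shelah lemma these have `O(m⁴ n²)` cells (`card_signVectors_le`).
-/

namespace PlanarEnvelope

/-! ### Affine functions on the plane -/

/-- The value at `p` of the affine function `(x, y) ↦ c.1 * x + c.2.1 * y + c.2.2`. Affine functions
on the plane are encoded by their triples of coefficients. -/
def ev (c : ℝ × ℝ × ℝ) (p : ℝ × ℝ) : ℝ := c.1 * p.1 + c.2.1 * p.2 + c.2.2

lemma continuous_ev (c : ℝ × ℝ × ℝ) : Continuous (ev c) := by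
  unfold ev; fun_prop

lemma ev_add (c d : ℝ × ℝ × ℝ) (p : ℝ × ℝ) : ev (c + d) p = ev c p + ev d p := by
  simp [ev]; ring

lemma ev_sub (c d : ℝ × ℝ × ℝ) (p : ℝ × ℝ) : ev (c - d) p = ev c p - ev d p := by
  simp [ev]; ring

lemma ev_smul (r : ℝ) (c : ℝ × ℝ × ℝ) (p : ℝ × ℝ) : ev (r • c) p = r * ev c p := by
  simp [ev]; ring

lemma ev_sum {κ : Type*} (s : Finset κ) (c : κ → ℝ × ℝ × ℝ) (p : ℝ × ℝ) :
    ev (∑ k ∈ s, c k) p = ∑ k ∈ s, ev (c k) p := by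
  classical
  induction s using Finset.induction_on with
  | empty => simp [ev]
  | insert a s ha ih => rw [Finset.sum_insert ha, Finset.sum_insert ha, ev_add, ih]

lemma ev_line (c : ℝ × ℝ × ℝ) (p q : ℝ × ℝ) (s : ℝ) :
    ev c (p + s • (q - p)) = ev c p + s * (ev c q - ev c p) := by
  simp [ev]; ring

lemma exists_ev_ne_zero {c : ℝ × ℝ × ℝ} (hc : c ≠ 0) {U : Set (ℝ × ℝ)} (hU : IsOpen U)
    (hne : U.Nonempty) : ∃ p ∈ U, ev c p ≠ 0 := by
  by_contra! h
  obtain ⟨p, hp⟩ := hne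
  have key : ∀ v : ℝ × ℝ, c.1 * v.1 + c.2.1 * v.2 = 0 := by
    intro v
    have hcont : Continuous fun s : ℝ => p + s • v := by fun_prop
    have hmem : (fun s : ℝ => p + s • v) ⁻¹' U ∈ nhds (0 : ℝ) :=
      (hU.preimage hcont).mem_nhds (by simpa using hp)
    obtain ⟨ε, hε, hball⟩ := Metric.mem_nhds_iff.1 hmem
    have h1 : p + (ε / 2) • v ∈ U := hball (by
      simp [abs_of_pos hε, hε])
    have h2 := h _ h1
    have h3 := h _ hp
    simp only [ev, Prod.fst_add, Prod.snd_add, Prod.smul_fst, Prod.smul_snd, smul_eq_mul] at h2 h3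
    have h4 : (ε / 2) * (c.1 * v.1 + c.2.1 * v.2) = 0 := by linarith
    exact (mul_eq_zero.1 h4).resolve_left (by positivity)
  have h1 : c.1 = 0 := by simpa using key (1, 0)
  have h2 : c.2.1 = 0 := by simpa using key (0, 1)
  have h3 : c.2.2 = 0 := by simpa [ev, h1, h2] using h p hp
  exact hc (by ext <;> simp [h1, h2, h3])

/-- A point of a nonempty open set can be chosen off the zero lines of finitely many nonzero affine
functions. -/
lemma exists_forall_ev_ne_zero (F : Finset (ℝ × ℝ × ℝ)) (hF : ∀ c ∈ F, c ≠ 0)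
    {U : Set (ℝ × ℝ)} (hU : IsOpen U) (hne : U.Nonempty) : ∃ p ∈ U, ∀ c ∈ F, ev c p ≠ 0 := by
  classical
  induction F using Finset.induction_on generalizing U with
  | empty => exact ⟨hne.choose, hne.choose_spec, by simp⟩
  | insert a s ha ih =>
    obtain ⟨q, hqU, hq⟩ := exists_ev_ne_zero (hF a (by simp)) hU hne
    have hV : IsOpen (U ∩ {p | ev a p ≠ 0}) :=
      hU.inter (isOpen_ne_fun (continuous_ev a) continuous_const)
    obtain ⟨p, hp, hps⟩ := ih (fun c hc => hF c (by simp [hc])) hV ⟨q, hqU, hq⟩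
    refine ⟨p, hp.1, ?_⟩
    intro c hc
    rcases Finset.mem_insert.1 hc with rfl | hc
    · exact hp.2
    · exact hps c hc

/-- `c i` is the only one of the functions `c j`, `j ∈ I`, that attains the minimum at `p`. -/
def StrictMin {ι : Type*} (I : Finset ι) (c : ι → ℝ × ℝ × ℝ) (i : ι) (p : ℝ × ℝ) : Prop :=
  ∀ j ∈ I, j ≠ i → ev (c i) p < ev (c j) p

/-- Composition of an affine function with the shear `(x, y) ↦ (x, s * x + y)`. -/
def shear (s : ℝ) (c : ℝ × ℝ × ℝ) : ℝ × ℝ × ℝ := (c.1 + s * c.2.1, c.2.1, c.2.2)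

lemma ev_shear (s : ℝ) (c : ℝ × ℝ × ℝ) (p : ℝ × ℝ) :
    ev (shear s c) (p.1, p.2 - s * p.1) = ev c p := by
  simp [ev, shear]; ring

/-- Functions with distinct gradients have, after some shear, distinct slopes in the first
direction. -/
lemma exists_shear_injOn {ι : Type*} (I : Finset ι) (c : ι → ℝ × ℝ × ℝ)
    (hc : Set.InjOn (fun i => ((c i).1, (c i).2.1)) I) :
    ∃ s : ℝ, Set.InjOn (fun i => (shear s (c i)).1) I := by
  classical
  obtain ⟨s, hs⟩ := Infinite.exists_notMem_finset
    ((I ×ˢ I).image fun z => -((c z.1).1 - (c z.2).1) / ((c z.1).2.1 - (c z.2).2.1))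
  refine ⟨s, fun i hi j hj hij => ?_⟩
  simp only [shear] at hij
  by_cases h : (c i).2.1 = (c j).2.1
  · refine hc hi hj ?_
    rw [h] at hij
    simp only [Prod.mk.injEq]
    exact ⟨by linarith, h⟩
  · exfalso
    refine hs (Finset.mem_image.2 ⟨(i, j), Finset.mem_product.2 ⟨hi, hj⟩, ?_⟩)
    have h' : (c i).2.1 - (c j).2.1 ≠ 0 := sub_ne_zero.2 h
    simp only
    rw [div_eq_iff h']
    linarith

/-! ### Edges of the envelope -/

section Sweep

variable {ι : Type*}

/-- The function `c i` is strictly minimal somewhere on the horizontal line at height `y`. -/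
def Alive (I : Finset ι) (c : ι → ℝ × ℝ × ℝ) (y : ℝ) (i : ι) : Prop :=
  ∃ x : ℝ, StrictMin I c i (x, y)

/-- All points but `p` of a segment from a point `p` of the closed region of `i` to a point `q` of the
open region lie in the open region. -/
lemma StrictMin.segment {I : Finset ι} {c : ι → ℝ × ℝ × ℝ} {i : ι} {p q : ℝ × ℝ}
    (hp : ∀ j ∈ I, ev (c i) p ≤ ev (c j) p) (hq : StrictMin I c i q) {s : ℝ} (h0 : 0 < s)
    (h1 : s ≤ 1) : StrictMin I c i (p + s • (q - p)) := by
  intro j hj hji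
  rw [ev_line, ev_line]
  nlinarith [mul_pos h0 (sub_pos.2 (hq j hj hji)), mul_nonneg (sub_nonneg.2 h1)
    (sub_nonneg.2 (hp j hj))]

lemma alive_of_segment {I : Finset ι} {c : ι → ℝ × ℝ × ℝ} {i : ι} {p : ℝ × ℝ} {y z : ℝ}
    (hp : ∀ j ∈ I, ev (c i) p ≤ ev (c j) p) (hz : Alive I c z i)
    (h : (p.2 < y ∧ y ≤ z) ∨ (z ≤ y ∧ y < p.2)) : Alive I c y i := by
  obtain ⟨x, hx⟩ := hz
  have hne : z - p.2 ≠ 0 := by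
    rcases h with h | h
    · exact (by linarith [h.1, h.2] : (0:ℝ) < z - p.2).ne'
    · exact (by linarith [h.1, h.2] : z - p.2 < 0).ne
  set s := (y - p.2) / (z - p.2) with hs
  have hs01 : 0 < s ∧ s ≤ 1 := by
    rcases h with h | h
    · have h3 : 0 < z - p.2 := by linarith [h.1, h.2]
      exact ⟨div_pos (by linarith [h.1]) h3, (div_le_one h3).2 (by linarith [h.2])⟩
    · have h3 : z - p.2 < 0 := by linarith [h.1, h.2]
      exact ⟨div_pos_of_neg_of_neg (by linarith [h.2]) h3,
        (div_le_one_of_neg h3).2 (by linarith [h.1])⟩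
  refine ⟨p.1 + s * (x - p.1), ?_⟩
  have hk := StrictMin.segment hp hx hs01.1 hs01.2
  have he : p + s • ((x, z) - p) = (p.1 + s * (x - p.1), y) := by
    ext
    · simp
    · simp only [Prod.snd_add, Prod.smul_snd, Prod.snd_sub, smul_eq_mul]
      rw [hs, div_mul_cancel₀ _ hne]; ring
  rwa [he] at hk

lemma Alive.between {I : Finset ι} {c : ι → ℝ × ℝ × ℝ} {i : ι} {y₁ y₂ y₃ : ℝ}
    (h₁ : Alive I c y₁ i) (h₃ : Alive I c y₃ i) (h12 : y₁ ≤ y₂) (h23 : y₂ ≤ y₃) :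
    Alive I c y₂ i := by
  rcases h12.eq_or_lt with rfl | h12
  · exact h₁
  obtain ⟨x, hx⟩ := h₁
  refine alive_of_segment (p := (x, y₁)) (fun j hj => ?_) h₃ (Or.inl ⟨h12, h23⟩)
  by_cases hji : j = i
  · rw [hji]
  · exact (hx j hj hji).le

/-- `i` and `j` are consecutive, in the order of the slopes, among the functions alive at height
`y`. -/
def Consecutive (I : Finset ι) (c : ι → ℝ × ℝ × ℝ) (y : ℝ) (e : ι × ι) : Prop :=
  Alive I c y e.1 ∧ Alive I c y e.2 ∧ (c e.1).1 < (c e.2).1 ∧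
    ∀ k ∈ I, Alive I c y k → (c e.1).1 < (c k).1 → (c e.2).1 ≤ (c k).1

/-- The graph of the envelope has an edge between `i` and `j`: these two alone attain the minimum
at some point. -/
def Adjacent (I : Finset ι) (c : ι → ℝ × ℝ × ℝ) (i j : ι) : Prop :=
  ∃ p, ev (c i) p = ev (c j) p ∧ ∀ k ∈ I, k ≠ i → k ≠ j → ev (c i) p < ev (c k) p

lemma Adjacent.alive {I : Finset ι} {c : ι → ℝ × ℝ × ℝ} {i j : ι} {p : ℝ × ℝ}
    (hij : (c i).1 ≠ (c j).1) (he : ev (c i) p = ev (c j) p)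
    (hk : ∀ k ∈ I, k ≠ i → k ≠ j → ev (c i) p < ev (c k) p) : Alive I c p.2 i := by
  have hcont : ∀ k, Continuous fun x : ℝ => ev (c k) (x, p.2) := fun k =>
    (continuous_ev (c k)).comp (by fun_prop)
  have h1 : ∀ᶠ x in nhds p.1, ∀ k ∈ I, k ≠ i → k ≠ j →
      ev (c i) (x, p.2) < ev (c k) (x, p.2) := by
    rw [Filter.eventually_all_finset]
    intro k hkI
    by_cases h : k ≠ i ∧ k ≠ j
    · filter_upwards [(hcont i).continuousAt.eventually_lt (hcont k).continuousAt
        (hk k hkI h.1 h.2)] with x hx _ _ using hx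
    · exact Filter.Eventually.of_forall fun x h1 h2 => (h ⟨h1, h2⟩).elim
  obtain ⟨ε, hε, hb⟩ := Metric.eventually_nhds_iff.1 h1
  have hval : ∀ x, ev (c j) (x, p.2) - ev (c i) (x, p.2) = ((c j).1 - (c i).1) * (x - p.1) := by
    intro x
    simp only [ev] at he ⊢
    linarith
  rcases lt_or_gt_of_ne hij with h | h
  · refine ⟨p.1 + ε / 2, fun k hkI hki => ?_⟩
    by_cases hkj : k = j
    · subst hkj
      have := hval (p.1 + ε / 2)
      nlinarith [mul_pos (sub_pos.2 h) hε]
    · exact hb (by simp [abs_of_pos hε, hε]) k hkI hki hkj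
  · refine ⟨p.1 - ε / 2, fun k hkI hki => ?_⟩
    by_cases hkj : k = j
    · subst hkj
      have := hval (p.1 - ε / 2)
      nlinarith [mul_pos (sub_pos.2 h) hε]
    · exact hb (by simp [abs_of_pos hε, hε]) k hkI hki hkj

lemma Adjacent.exists_consecutive {I : Finset ι} {c : ι → ℝ × ℝ × ℝ} {i j : ι}
    (hij : (c i).1 < (c j).1) (h : Adjacent I c i j) (hi : i ∈ I) (hj : j ∈ I) :
    ∃ y, Consecutive I c y (i, j) := by
  obtain ⟨p, he, hk⟩ := h
  refine ⟨p.2, Adjacent.alive hij.ne he hk, Adjacent.alive hij.ne' he.symm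
    (fun k hkI h1 h2 => he ▸ hk k hkI h2 h1), hij, ?_⟩
  intro k hkI ⟨x, hx⟩ hik
  by_contra! hkj
  have hki : k ≠ i := by rintro rfl; exact lt_irrefl _ hik
  have hkj' : k ≠ j := by rintro rfl; exact lt_irrefl _ hkj
  have h0 := hk k hkI hki hkj'
  have h1 := hx i hi hki.symm
  have h2 := hx j hj hkj'.symm
  simp only [ev] at he h0 h1 h2
  simp only at hkj hik
  -- To the right of `p` the function `i` stays below `k`, and to the left `j` does.
  rcases le_total p.1 x with hpx | hpx
  · nlinarith [mul_nonneg (sub_nonneg.2 hik.le) (sub_nonneg.2 hpx)]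
  · nlinarith [mul_nonneg (sub_nonneg.2 hkj.le) (sub_nonneg.2 hpx)]

/-- Two pairs of consecutive functions whose slope intervals overlap are equal. So an element has at
most one right neighbour, one left neighbour, and one gap that contains it. -/
lemma Consecutive.unique {I : Finset ι} {c : ι → ℝ × ℝ × ℝ} (hc : Set.InjOn (fun i => (c i).1) I)
    {y : ℝ} {e f : ι × ι} (he : Consecutive I c y e) (hf : Consecutive I c y f)
    (heI : e.1 ∈ I ∧ e.2 ∈ I) (hfI : f.1 ∈ I ∧ f.2 ∈ I)
    (h1 : (c e.1).1 < (c f.2).1) (h2 : (c f.1).1 < (c e.2).1) : e = f := by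
  have a1 := he.2.2.2 f.2 hfI.2 hf.2.1 h1
  have a2 := hf.2.2.2 e.2 heI.2 he.2.1 h2
  have a3 : (c e.1).1 = (c f.1).1 := by
    rcases lt_trichotomy (c e.1).1 (c f.1).1 with h | h | h
    · linarith [he.2.2.2 f.1 hfI.1 hf.1 h]
    · exact h
    · linarith [hf.2.2.2 e.1 heI.1 he.1 h]
  exact Prod.ext (hc heI.1 hfI.1 a3) (hc heI.2 hfI.2 (le_antisymm a1 a2))

/-- The envelope of finitely many affine functions on the plane has linearly many edges. A
horizontal line sweeps the plane upwards; each function is alive during an interval of time, so it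
is born and dies at most once. When two functions become neighbours, the left one or the right one
is born, or a function between them dies, and this event determines the pair. -/
theorem card_adjacent_le {I : Finset ι} {c : ι → ℝ × ℝ × ℝ}
    (hc : Set.InjOn (fun i => (c i).1) I) (E : Finset (ι × ι))
    (hE : ∀ e ∈ E, e.1 ∈ I ∧ e.2 ∈ I ∧ (c e.1).1 < (c e.2).1 ∧ Adjacent I c e.1 e.2) :
    E.card ≤ 3 * I.card := by
  classical
  have hy : ∀ e : ι × ι, ∃ y, e ∈ E → Consecutive I c y e := by
    intro e
    by_cases he : e ∈ E
    · obtain ⟨h1, h2, h3, h4⟩ := hE e he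
      obtain ⟨y, hy⟩ := Adjacent.exists_consecutive h3 h4 h1 h2
      exact ⟨y, fun _ => hy⟩
    · exact ⟨0, fun h => (he h).elim⟩
  choose Y hY using hy
  set T := E.image Y with hT
  have hcard : (I ×ˢ (Finset.univ : Finset (Fin 3))).card = 3 * I.card := by
    rw [Finset.card_product]; simp [mul_comm]
  rw [← hcard]
  let r : ι × ι → ι × Fin 3 → Prop := fun e z => ∃ y ∈ T, Consecutive I c y e ∧
    ((z.2 = 0 ∧ z.1 = e.1 ∧ ∀ y' ∈ T, y' < y → ¬ Alive I c y' z.1) ∨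
     (z.2 = 1 ∧ z.1 = e.2 ∧ ∀ y' ∈ T, y' < y → ¬ Alive I c y' z.1) ∨
     (z.2 = 2 ∧ (c e.1).1 < (c z.1).1 ∧ (c z.1).1 < (c e.2).1 ∧ ¬ Alive I c y z.1 ∧
        ∃ y' ∈ T, y' < y ∧ Alive I c y' z.1 ∧ ∀ y'' ∈ T, y'' < y → y'' ≤ y'))
  refine Finset.card_le_card_of_forall_subsingleton r ?_ ?_
  · intro e he
    have hne : (T.filter fun y => Consecutive I c y e).Nonempty :=
      ⟨Y e, Finset.mem_filter.2 ⟨Finset.mem_image_of_mem _ he, hY e he⟩⟩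
    obtain ⟨y, hyT, hymin⟩ := Finset.exists_min_image _ id hne
    obtain ⟨hyT, hyc⟩ := Finset.mem_filter.1 hyT
    obtain ⟨hI1, hI2, hlt, -⟩ := hE e he
    by_cases hfirst : ∀ y' ∈ T, ¬ y' < y
    · exact ⟨(e.1, 0), by simp [hI1], y, hyT, hyc, Or.inl ⟨rfl, rfl,
        fun y' h1 h2 => (hfirst y' h1 h2).elim⟩⟩
    push Not at hfirst
    obtain ⟨w, hw1, hw2⟩ := hfirst
    obtain ⟨y', hy', hmax⟩ := Finset.exists_max_image (T.filter fun y' => y' < y) id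
      ⟨w, Finset.mem_filter.2 ⟨hw1, hw2⟩⟩
    obtain ⟨hy'T, hy'y⟩ := Finset.mem_filter.1 hy'
    have hmax' : ∀ y'' ∈ T, y'' < y → y'' ≤ y' := fun y'' h1 h2 =>
      hmax y'' (Finset.mem_filter.2 ⟨h1, h2⟩)
    have hnc : ¬ Consecutive I c y' e := fun h =>
      absurd (hymin y' (Finset.mem_filter.2 ⟨hy'T, h⟩)) (not_le.2 hy'y)
    by_cases ha1 : Alive I c y' e.1
    · by_cases ha2 : Alive I c y' e.2
      · have : ∃ k ∈ I, Alive I c y' k ∧ (c e.1).1 < (c k).1 ∧ (c k).1 < (c e.2).1 := by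
          by_contra! hcon
          exact hnc ⟨ha1, ha2, hlt, hcon⟩
        obtain ⟨k, hkI, hka, hk1, hk2⟩ := this
        refine ⟨(k, 2), by simp [hkI], y, hyT, hyc, Or.inr (Or.inr ⟨rfl, hk1, hk2, ?_, y', hy'T,
          hy'y, hka, hmax'⟩)⟩
        intro hal
        exact absurd (hyc.2.2.2 k hkI hal hk1) (not_le.2 hk2)
      · exact ⟨(e.2, 1), by simp [hI2], y, hyT, hyc, Or.inr (Or.inl ⟨rfl, rfl, fun y'' h1 h2 h3 =>
          ha2 (h3.between hyc.2.1 (hmax' y'' h1 h2) hy'y.le)⟩)⟩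
    · exact ⟨(e.1, 0), by simp [hI1], y, hyT, hyc, Or.inl ⟨rfl, rfl, fun y'' h1 h2 h3 =>
          ha1 (h3.between hyc.1 (hmax' y'' h1 h2) hy'y.le)⟩⟩
  · rintro ⟨k, l⟩ - e ⟨heE, y, hyT, hyc, hre⟩ f ⟨hfE, z, hzT, hzc, hrf⟩
    obtain ⟨he1, he2, hel, -⟩ := hE e heE
    obtain ⟨hf1, hf2, hfl, -⟩ := hE f hfE
    simp only at hre hrf
    rcases hre with ⟨rfl, rfl, hre⟩ | ⟨rfl, rfl, hre⟩ | ⟨rfl, h1, h2, h3, y', h4, h5, h6, h7⟩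
    · obtain ⟨h8, hrf⟩ : e.1 = f.1 ∧ ∀ y' ∈ T, y' < z → ¬ Alive I c y' e.1 := by
        simpa using hrf
      have hyz : y = z := by
        rcases lt_trichotomy y z with h | h | h
        · exact (hrf y hyT h hyc.1).elim
        · exact h
        · exact (hre z hzT h (h8 ▸ hzc.1)).elim
      subst hyz
      exact Consecutive.unique hc hyc hzc ⟨he1, he2⟩ ⟨hf1, hf2⟩ (h8 ▸ hfl) (h8 ▸ hel)
    · obtain ⟨h8, hrf⟩ : e.2 = f.2 ∧ ∀ y' ∈ T, y' < z → ¬ Alive I c y' e.2 := by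
        simpa using hrf
      have hyz : y = z := by
        rcases lt_trichotomy y z with h | h | h
        · exact (hrf y hyT h hyc.2.1).elim
        · exact h
        · exact (hre z hzT h (h8 ▸ hzc.2.1)).elim
      subst hyz
      exact Consecutive.unique hc hyc hzc ⟨he1, he2⟩ ⟨hf1, hf2⟩ (h8 ▸ hel) (h8 ▸ hfl)
    · obtain ⟨g1, g2, g3, z', g4, g5, g6, g7⟩ : (c f.1).1 < (c k).1 ∧ (c k).1 < (c f.2).1 ∧
          ¬ Alive I c z k ∧ ∃ y' ∈ T, y' < z ∧ Alive I c y' k ∧ ∀ y'' ∈ T, y'' < z → y'' ≤ y' := by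
        simpa using hrf
      have hyz : y = z := by
        rcases lt_trichotomy y z with h | h | h
        · exact (h3 (h6.between g6 h5.le (g7 y hyT h))).elim
        · exact h
        · exact (g3 (g6.between h6 g5.le (h7 z hzT h))).elim
      subst hyz
      exact Consecutive.unique hc hyc hzc ⟨he1, he2⟩ ⟨hf1, hf2⟩ (h1.trans g2) (g1.trans h2)

end Sweep

/-! ### Faces of the envelope -/

section Faces

open scoped Classical in
/-- The functions that attain the minimum at `p`. -/
noncomputable def active {ι : Type*} (I : Finset ι) (c : ι → ℝ × ℝ × ℝ) (p : ℝ × ℝ) : Finset ι :=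
  I.filter fun i => ∀ j ∈ I, ev (c i) p ≤ ev (c j) p

variable {ι : Type*} {I : Finset ι} {c : ι → ℝ × ℝ × ℝ}

lemma mem_active {p : ℝ × ℝ} {i : ι} :
    i ∈ active I c p ↔ i ∈ I ∧ ∀ j ∈ I, ev (c i) p ≤ ev (c j) p := by
  simp [active]

lemma active_nonempty (hI : I.Nonempty) (p : ℝ × ℝ) : (active I c p).Nonempty := by
  obtain ⟨i, hi, h⟩ := Finset.exists_min_image I (fun i => ev (c i) p) hI
  exact ⟨i, mem_active.2 ⟨hi, h⟩⟩

lemma ev_eq_of_mem_active {p : ℝ × ℝ} {i j : ι} (hi : i ∈ active I c p) (hj : j ∈ active I c p) :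
    ev (c i) p = ev (c j) p :=
  le_antisymm ((mem_active.1 hi).2 j (mem_active.1 hj).1)
    ((mem_active.1 hj).2 i (mem_active.1 hi).1)

lemma lt_of_mem_active {p : ℝ × ℝ} {i j : ι} (hi : i ∈ active I c p) (hj : j ∈ I)
    (hj' : j ∉ active I c p) : ev (c i) p < ev (c j) p := by
  rw [mem_active] at hi hj'
  push Not at hj'
  obtain ⟨k, hk, h⟩ := hj' hj
  exact (hi.2 k hk).trans_lt h

/-- A function that is active at `p` together with one of smaller and one of larger slope is not
minimal at any other point of the horizontal line through `p`. -/
lemma eq_of_mem_active_of_slopes {p : ℝ × ℝ} {i j k : ι} (hi : i ∈ active I c p)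
    (hj : j ∈ active I c p) (hk : k ∈ active I c p) (hik : (c i).1 < (c k).1)
    (hkj : (c k).1 < (c j).1) {x : ℝ} (hx : ∀ l ∈ I, ev (c k) (x, p.2) ≤ ev (c l) (x, p.2)) :
    x = p.1 := by
  have h1 := hx i (mem_active.1 hi).1
  have h2 := hx j (mem_active.1 hj).1
  have h3 := ev_eq_of_mem_active hi hk
  have h4 := ev_eq_of_mem_active hj hk
  simp only [ev] at h1 h2 h3 h4
  rcases lt_trichotomy x p.1 with h | h | h
  · nlinarith [mul_pos (sub_pos.2 hkj) (sub_pos.2 h)]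
  · exact h
  · nlinarith [mul_pos (sub_pos.2 hik) (sub_pos.2 h)]

lemma exists_intermediate_slope (hc : Set.InjOn (fun i => (c i).1) I) {f : Finset ι} (hf : f ⊆ I)
    (h3 : 3 ≤ f.card) : ∃ i ∈ f, ∃ k ∈ f, ∃ j ∈ f, (c i).1 < (c k).1 ∧ (c k).1 < (c j).1 := by
  classical
  have hne : f.Nonempty := Finset.card_pos.1 (by omega)
  obtain ⟨i, hi, himin⟩ := Finset.exists_min_image f (fun i => (c i).1) hne
  obtain ⟨j, hj, hjmax⟩ := Finset.exists_max_image f (fun i => (c i).1) hne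
  have : (f \ {i, j}).Nonempty := by
    rw [← Finset.card_pos]
    have h := Finset.le_card_sdiff {i, j} f
    have h2 : ({i, j} : Finset ι).card ≤ 2 := Finset.card_le_two
    omega
  obtain ⟨k, hk⟩ := this
  simp only [Finset.mem_sdiff, Finset.mem_insert, Finset.mem_singleton, not_or] at hk
  refine ⟨i, hi, k, hk.1, j, hj, lt_of_le_of_ne (himin k hk.1) ?_,
    lt_of_le_of_ne (hjmax k hk.1) ?_⟩
  · exact fun h => hk.2.1 (hc (hf hk.1) (hf hi) h.symm)
  · exact fun h => hk.2.2 (hc (hf hk.1) (hf hj) h)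

/-- A vertex of the envelope is the lowest or the highest point of the region of an active function
of intermediate slope, so there are at most twice as many vertices as functions. -/
lemma card_vertices_le (hc : Set.InjOn (fun i => (c i).1) I)
    (hI : ∀ i ∈ I, ∃ p, StrictMin I c i p) (F : Finset (Finset ι))
    (hF : ∀ f ∈ F, ∃ p, f = active I c p) (h3 : ∀ f ∈ F, 3 ≤ f.card) : F.card ≤ 2 * I.card := by
  classical
  have hcard : (I ×ˢ (Finset.univ : Finset Bool)).card = 2 * I.card := by
    rw [Finset.card_product]; simp [mul_comm]
  rw [← hcard]
  let r : Finset ι → ι × Bool → Prop := fun f z => ∃ p, f = active I c p ∧ z.1 ∈ f ∧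
    (∃ i ∈ f, ∃ j ∈ f, (c i).1 < (c z.1).1 ∧ (c z.1).1 < (c j).1) ∧
    ((z.2 = true ∧ ∃ y, p.2 < y ∧ Alive I c y z.1) ∨
      (z.2 = false ∧ ∃ y, y < p.2 ∧ Alive I c y z.1))
  -- At the height of a vertex, an active function of intermediate slope is not alive.
  have hdead : ∀ (p : ℝ × ℝ) (k : ι), k ∈ active I c p →
      (∃ i ∈ active I c p, ∃ j ∈ active I c p, (c i).1 < (c k).1 ∧ (c k).1 < (c j).1) →
      ¬ Alive I c p.2 k := by
    rintro p k hk ⟨i, hi, j, hj, hik, hkj⟩ ⟨x, hx⟩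
    have hxp : x = p.1 := eq_of_mem_active_of_slopes hi hj hk hik hkj fun l hl => by
      by_cases h : l = k
      · rw [h]
      · exact (hx l hl h).le
    subst hxp
    exact absurd (ev_eq_of_mem_active hk hi)
      (hx i (mem_active.1 hi).1 (by rintro rfl; exact lt_irrefl _ hik)).ne
  refine Finset.card_le_card_of_forall_subsingleton r ?_ ?_
  · intro f hf
    obtain ⟨p, rfl⟩ := hF f hf
    obtain ⟨i, hi, k, hk, j, hj, hik, hkj⟩ := exists_intermediate_slope hc
      (fun i hi => (mem_active.1 hi).1) (h3 _ hf)
    obtain ⟨q, hq⟩ := hI k (mem_active.1 hk).1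
    have hd := hdead p k hk ⟨i, hi, j, hj, hik, hkj⟩
    have hal : Alive I c q.2 k := ⟨q.1, hq⟩
    rcases lt_trichotomy p.2 q.2 with h | h | h
    · exact ⟨(k, true), by simp [(mem_active.1 hk).1], p, rfl, hk, ⟨i, hi, j, hj, hik, hkj⟩,
        Or.inl ⟨rfl, q.2, h, hal⟩⟩
    · exact (hd (h ▸ hal)).elim
    · exact ⟨(k, false), by simp [(mem_active.1 hk).1], p, rfl, hk, ⟨i, hi, j, hj, hik, hkj⟩,
        Or.inr ⟨rfl, q.2, h, hal⟩⟩
  · rintro ⟨k, b⟩ - f ⟨-, p, rfl, hkp, hsp, hp⟩ g ⟨-, q, rfl, hkq, hsq, hq⟩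
    simp only at hkp hkq hsp hsq hp hq
    have hdp := hdead p k hkp hsp
    have hdq := hdead q k hkq hsq
    have hheight : p.2 = q.2 := by
      rcases hp with ⟨rfl, y, hpy, hy⟩ | ⟨rfl, y, hpy, hy⟩
      · obtain ⟨z, hqz, hz⟩ : ∃ z, q.2 < z ∧ Alive I c z k := by simpa using hq
        rcases lt_trichotomy p.2 q.2 with h | h | h
        · exact (hdq (alive_of_segment (mem_active.1 hkp).2 hz (Or.inl ⟨h, hqz.le⟩))).elim
        · exact h
        · exact (hdp (alive_of_segment (mem_active.1 hkq).2 hy (Or.inl ⟨h, hpy.le⟩))).elim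
      · obtain ⟨z, hqz, hz⟩ : ∃ z, z < q.2 ∧ Alive I c z k := by simpa using hq
        rcases lt_trichotomy p.2 q.2 with h | h | h
        · exact (hdp (alive_of_segment (mem_active.1 hkq).2 hy (Or.inr ⟨hpy.le, h⟩))).elim
        · exact h
        · exact (hdq (alive_of_segment (mem_active.1 hkp).2 hz (Or.inr ⟨hqz.le, h⟩))).elim
    obtain ⟨i, hi, j, hj, hik, hkj⟩ := hsp
    have hx : q.1 = p.1 := eq_of_mem_active_of_slopes hi hj hkp hik hkj (x := q.1)
      (by rw [hheight]; exact (mem_active.1 hkq).2)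
    rw [show p = q from Prod.ext hx.symm hheight]

/-- The number of faces, of all dimensions, of an envelope to which every function contributes a
region is linear in the number of functions. -/
lemma card_faces_le_of_injOn (hne : I.Nonempty) (hc : Set.InjOn (fun i => (c i).1) I)
    (hI : ∀ i ∈ I, ∃ p, StrictMin I c i p) (F : Finset (Finset ι))
    (hF : ∀ f ∈ F, ∃ p, f = active I c p) : F.card ≤ 6 * I.card := by
  classical
  set E := (I ×ˢ I).filter fun e => (c e.1).1 < (c e.2).1 ∧ Adjacent I c e.1 e.2 with hE
  have hEcard : E.card ≤ 3 * I.card := card_adjacent_le hc E fun e he => by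
    obtain ⟨h1, h2⟩ := Finset.mem_filter.1 he
    exact ⟨(Finset.mem_product.1 h1).1, (Finset.mem_product.1 h1).2, h2⟩
  have hsub : F ⊆ (I.image fun i => {i}) ∪ (E.image fun e => {e.1, e.2}) ∪
      F.filter fun f => 3 ≤ f.card := by
    intro f hf
    obtain ⟨p, hp⟩ := hF f hf
    have hfne : 0 < f.card := Finset.card_pos.2 (hp ▸ active_nonempty hne p)
    have hfI : ∀ i ∈ f, i ∈ I := fun i hi => (mem_active.1 (hp ▸ hi)).1
    rcases (by omega : f.card = 1 ∨ f.card = 2 ∨ 3 ≤ f.card) with h | h | h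
    · obtain ⟨i, rfl⟩ := Finset.card_eq_one.1 h
      exact Finset.mem_union_left _ (Finset.mem_union_left _
        (Finset.mem_image.2 ⟨i, hfI i (by simp), rfl⟩))
    · obtain ⟨i, j, hij, rfl⟩ := Finset.card_eq_two.1 h
      refine Finset.mem_union_left _ (Finset.mem_union_right _ ?_)
      have hi := hfI i (by simp)
      have hj := hfI j (by simp)
      have hip : i ∈ active I c p := hp ▸ (by simp)
      have hjp : j ∈ active I c p := hp ▸ (by simp)
      have hlt : ∀ k ∈ I, k ≠ i → k ≠ j → ev (c i) p < ev (c k) p := fun k hk h1 h2 =>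
        lt_of_mem_active hip hk (by rw [← hp]; simp [h1, h2])
      have heq := ev_eq_of_mem_active hip hjp
      rcases lt_trichotomy (c i).1 (c j).1 with h' | h' | h'
      · exact Finset.mem_image.2 ⟨(i, j), Finset.mem_filter.2 ⟨Finset.mem_product.2 ⟨hi, hj⟩, h',
          p, heq, hlt⟩, rfl⟩
      · exact (hij (hc hi hj h')).elim
      · exact Finset.mem_image.2 ⟨(j, i), Finset.mem_filter.2 ⟨Finset.mem_product.2 ⟨hj, hi⟩, h',
          p, heq.symm, fun k hk h1 h2 => heq ▸ hlt k hk h2 h1⟩, Finset.pair_comm _ _⟩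
    · exact Finset.mem_union_right _ (Finset.mem_filter.2 ⟨hf, h⟩)
  have hV := card_vertices_le hc hI (F.filter fun f => 3 ≤ f.card)
    (fun f hf => hF f (Finset.mem_filter.1 hf).1) (fun f hf => (Finset.mem_filter.1 hf).2)
  have h1 := Finset.card_le_card hsub
  have h2 := Finset.card_union_le ((I.image fun i => ({i} : Finset ι)) ∪
    (E.image fun e => ({e.1, e.2} : Finset ι))) (F.filter fun f => 3 ≤ f.card)
  have h3 := Finset.card_union_le (I.image fun i => ({i} : Finset ι))
    (E.image fun e => ({e.1, e.2} : Finset ι))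
  have h4 : (I.image fun i => ({i} : Finset ι)).card ≤ I.card := Finset.card_image_le
  have h5 : (E.image fun e => ({e.1, e.2} : Finset ι)).card ≤ E.card := Finset.card_image_le
  omega

lemma exists_isOpen_active_subset (p : ℝ × ℝ) :
    ∃ U : Set (ℝ × ℝ), IsOpen U ∧ p ∈ U ∧ ∀ q ∈ U, active I c q ⊆ active I c p := by
  classical
  have h : ∀ᶠ q in nhds p, ∀ i ∈ I, ∀ j ∈ I, ev (c i) p < ev (c j) p →
      ev (c i) q < ev (c j) q := by
    rw [Filter.eventually_all_finset]
    intro i _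
    rw [Filter.eventually_all_finset]
    intro j _
    by_cases hij : ev (c i) p < ev (c j) p
    · filter_upwards [(continuous_ev (c i)).continuousAt.eventually_lt
        (continuous_ev (c j)).continuousAt hij] with q hq _ using hq
    · exact Filter.Eventually.of_forall fun q h => (hij h).elim
  obtain ⟨U, hU, hUo, hpU⟩ := eventually_nhds_iff.1 h
  refine ⟨U, hUo, hpU, fun q hq i hi => ?_⟩
  rw [mem_active] at hi ⊢
  refine ⟨hi.1, fun j hj => ?_⟩
  by_contra! hlt
  exact absurd (hU q hq j hj i hi.1 hlt) (not_lt.2 (hi.2 j hj))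

open scoped Classical in
/-- The affine functions of the family `Φ` that contribute a two-dimensional region. -/
noncomputable def regionFunctions (Φ : Finset (ℝ × ℝ × ℝ)) : Finset (ℝ × ℝ × ℝ) :=
  Φ.filter fun c => ∃ p, StrictMin Φ id c p

lemma exists_mem_regionFunctions {Φ : Finset (ℝ × ℝ × ℝ)} (hΦ : Φ.Nonempty) (p : ℝ × ℝ) :
    ∃ c ∈ regionFunctions Φ, c ∈ active Φ id p := by
  classical
  obtain ⟨U, hU, hpU, hsub⟩ := exists_isOpen_active_subset (I := Φ) (c := id) p
  obtain ⟨q, hqU, hq⟩ := exists_forall_ev_ne_zero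
    (((Φ ×ˢ Φ).image fun z => z.1 - z.2).erase 0) (fun _ h => Finset.ne_of_mem_erase h) hU ⟨p, hpU⟩
  obtain ⟨c, hc⟩ := active_nonempty (c := id) hΦ q
  refine ⟨c, Finset.mem_filter.2 ⟨(mem_active.1 hc).1, q, fun d hd hdc => ?_⟩, hsub q hqU hc⟩
  refine lt_of_le_of_ne ((mem_active.1 hc).2 d hd) fun h => ?_
  refine hq (c - d) (Finset.mem_erase.2 ⟨sub_ne_zero.2 hdc.symm, Finset.mem_image.2
    ⟨(c, d), Finset.mem_product.2 ⟨(mem_active.1 hc).1, hd⟩, rfl⟩⟩) ?_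
  rw [ev_sub]
  simpa [sub_eq_zero] using h

lemma active_regionFunctions {Φ : Finset (ℝ × ℝ × ℝ)} (hΦ : Φ.Nonempty) (p : ℝ × ℝ)
    {c : ℝ × ℝ × ℝ} : c ∈ active (regionFunctions Φ) id p ↔
      c ∈ regionFunctions Φ ∧ c ∈ active Φ id p := by
  classical
  obtain ⟨c₀, hc₀, hc₀p⟩ := exists_mem_regionFunctions hΦ p
  have hsub : ∀ d ∈ regionFunctions Φ, d ∈ Φ := fun d hd => (Finset.mem_filter.1 hd).1
  rw [mem_active]
  constructor
  · rintro ⟨h1, h2⟩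
    exact ⟨h1, mem_active.2 ⟨hsub c h1, fun d hd => (h2 c₀ hc₀).trans ((mem_active.1 hc₀p).2 d hd)⟩⟩
  · rintro ⟨h1, h2⟩
    exact ⟨h1, fun d hd => (mem_active.1 h2).2 d (hsub d hd)⟩

/-- A face of the envelope is determined by those of its active functions that contribute a region.
If a function `d` were active at `p` but not at `q`, it would drop below the envelope just behind
`p` on the line from `q` to `p`. -/
lemma active_subset_of_regionFunctions {Φ : Finset (ℝ × ℝ × ℝ)} (hΦ : Φ.Nonempty) {p q : ℝ × ℝ}
    (h : active (regionFunctions Φ) id p = active (regionFunctions Φ) id q) :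
    active Φ id p ⊆ active Φ id q := by
  intro d hd
  obtain ⟨c₀, hc₀, hc₀p⟩ := exists_mem_regionFunctions hΦ p
  have hpq : ∀ c, c ∈ regionFunctions Φ → c ∈ active Φ id p → c ∈ active Φ id q := fun c h1 h2 =>
    ((active_regionFunctions hΦ q).1 (h ▸ (active_regionFunctions hΦ p).2 ⟨h1, h2⟩)).2
  have hc₀q := hpq c₀ hc₀ hc₀p
  by_contra hdq
  have hlt := lt_of_mem_active hc₀q (mem_active.1 hd).1 hdq
  have heq := ev_eq_of_mem_active hd hc₀p
  obtain ⟨U, hU, hpU, hsub⟩ := exists_isOpen_active_subset (I := Φ) (c := id) p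
  have hcont : Continuous fun s : ℝ => p + s • (q - p) := by fun_prop
  have hmem : (fun s : ℝ => p + s • (q - p)) ⁻¹' U ∈ nhds (0 : ℝ) :=
    (hU.preimage hcont).mem_nhds (by simpa using hpU)
  obtain ⟨ε, hε, hball⟩ := Metric.mem_nhds_iff.1 hmem
  set r := p + (-(ε / 2)) • (q - p) with hr
  have hrU : r ∈ U := hball (by simp [abs_of_pos hε, hε])
  obtain ⟨c, hc, hcr⟩ := exists_mem_regionFunctions hΦ r
  have hcp := hsub r hrU hcr
  have hcq := hpq c hc hcp
  have e1 := ev_eq_of_mem_active hcp hc₀p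
  have e2 := ev_eq_of_mem_active hcq hc₀q
  have e3 := (mem_active.1 hcr).2 d (mem_active.1 hd).1
  simp only [id] at e1 e2 e3 hlt heq
  rw [hr, ev_line, ev_line] at e3
  nlinarith

/-- The number of faces, of all dimensions, of the lower envelope of finitely many affine functions
on the plane is linear in the number of its two-dimensional regions. -/
theorem card_faces_le {Φ : Finset (ℝ × ℝ × ℝ)} (hΦ : Φ.Nonempty)
    (F : Finset (Finset (ℝ × ℝ × ℝ))) (hF : ∀ f ∈ F, ∃ p, f = active Φ id p) :
    F.card ≤ 6 * (regionFunctions Φ).card := by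
  classical
  set J := regionFunctions Φ with hJ
  have hJΦ : ∀ d ∈ J, d ∈ Φ := fun d hd => (Finset.mem_filter.1 hd).1
  have hJmin : ∀ d ∈ J, ∃ p, StrictMin J id d p := fun d hd => by
    obtain ⟨p, hp⟩ := (Finset.mem_filter.1 hd).2
    exact ⟨p, fun j hj => hp j (hJΦ j hj)⟩
  have hgrad : Set.InjOn (fun c : ℝ × ℝ × ℝ => (c.1, c.2.1)) J := by
    intro a ha b hb hab
    by_contra hne
    obtain ⟨p, hp⟩ := hJmin a ha
    obtain ⟨q, hq⟩ := hJmin b hb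
    have h1 := hp b hb (Ne.symm hne)
    have h2 := hq a ha hne
    simp only [Prod.mk.injEq] at hab
    simp only [ev, id, hab.1, hab.2] at h1 h2
    linarith
  obtain ⟨s, hs⟩ := exists_shear_injOn J id hgrad
  obtain ⟨c₀, hc₀, -⟩ := exists_mem_regionFunctions hΦ 0
  have hinj : Set.InjOn (fun f : Finset (ℝ × ℝ × ℝ) => f.filter (· ∈ J)) F := by
    intro f hf g hg hfg
    obtain ⟨p, rfl⟩ := hF f hf
    obtain ⟨q, rfl⟩ := hF g hg
    have : active J id p = active J id q := by
      ext c
      have := Finset.ext_iff.1 hfg c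
      simp only [Finset.mem_filter] at this
      rw [active_regionFunctions hΦ, active_regionFunctions hΦ, and_comm, this, and_comm]
    exact Finset.Subset.antisymm (active_subset_of_regionFunctions hΦ this)
      (active_subset_of_regionFunctions hΦ this.symm)
  rw [← Finset.card_image_of_injOn hinj]
  refine card_faces_le_of_injOn (c := shear s) ⟨c₀, hc₀⟩ hs ?_ _ ?_
  · intro i hi
    obtain ⟨p, hp⟩ := hJmin i hi
    refine ⟨(p.1, p.2 - s * p.1), fun j hj hji => ?_⟩
    rw [ev_shear, ev_shear]
    exact hp j hj hji
  · intro f hf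
    obtain ⟨g, hg, rfl⟩ := Finset.mem_image.1 hf
    obtain ⟨p, rfl⟩ := hF g hg
    refine ⟨(p.1, p.2 - s * p.1), ?_⟩
    ext c
    rw [Finset.mem_filter, and_comm, ← active_regionFunctions hΦ, mem_active, mem_active]
    simp only [ev_shear, id]

end Faces

/-! ### Ties at a low level -/

section LowLevelTies

variable {ι : Type*}

open scoped Classical in
/-- `i` and `j`, and no other function of the family, take the same value at `p`, and at most `k`
functions are smaller there. -/
def LowTie (I : Finset ι) (c : ι → ℝ × ℝ × ℝ) (k : ℕ) (i j : ι) (p : ℝ × ℝ) : Prop :=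
  ev (c i) p = ev (c j) p ∧ (∀ l ∈ I, l ≠ i → l ≠ j → ev (c l) p ≠ ev (c i) p) ∧
    (I.filter fun l => ev (c l) p < ev (c i) p).card ≤ k

lemma LowTie.symm {I : Finset ι} {c : ι → ℝ × ℝ × ℝ} {k : ℕ} {i j : ι} {p : ℝ × ℝ}
    (h : LowTie I c k i j p) : LowTie I c k j i p := by
  refine ⟨h.1.symm, fun l hl h1 h2 => h.1 ▸ h.2.1 l hl h2 h1, ?_⟩
  rw [← h.1]
  exact h.2.2

open scoped Classical in
lemma card_colorings {I : Finset ι} {q : ℕ} (s : I → Finset (Fin q)) :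
    ((Finset.univ.filter fun f : I → Fin q => ∀ l, f l ∈ s l).card : ℝ) = ∏ l, ((s l).card : ℝ) := by
  have : (Finset.univ.filter fun f : I → Fin q => ∀ l, f l ∈ s l) = Fintype.piFinset s := by
    ext f; simp
  rw [this, Fintype.card_piFinset]
  push_cast
  rfl

/-- A family of `n` affine functions with distinct slopes has `O(k n)` pairs that are tied at a
point with at most `k` smaller functions. This is the sampling argument of Clarkson and Shor: colour
the functions at random with `2 (k + 1)` colours. Such a pair is an edge of the envelope of the
first colour class with a probability at least half of `(2 (k + 1))⁻²`, and that envelope has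
linearly many edges. -/
lemma card_lowTie_le_of_injOn {I : Finset ι} {c : ι → ℝ × ℝ × ℝ}
    (hc : Set.InjOn (fun i => (c i).1) I) (k : ℕ) (E : Finset (ι × ι))
    (hE : ∀ e ∈ E, e.1 ∈ I ∧ e.2 ∈ I ∧ (c e.1).1 < (c e.2).1 ∧ ∃ p, LowTie I c k e.1 e.2 p) :
    E.card ≤ 12 * (k + 1) * I.card := by
  classical
  set q : ℕ := 2 * (k + 1) with hq
  have : NeZero q := ⟨by omega⟩
  have hq0 : (0 : ℝ) < q := by rw [hq]; positivity
  let S : (I → Fin q) → Finset ι := fun f => (Finset.univ.filter fun l => f l = 0).image Subtype.val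
  have hSI : ∀ f, S f ⊆ I := by
    intro f i hi
    obtain ⟨l, -, rfl⟩ := Finset.mem_image.1 hi
    exact l.2
  have hmemS : ∀ f (l : I), (l : ι) ∈ S f ↔ f l = 0 := by
    intro f l; simp [S]
  let good : (I → Fin q) → ι × ι → Prop := fun f e => e.1 ∈ S f ∧ e.2 ∈ S f ∧
    Adjacent (S f) c e.1 e.2
  -- Every colour class has few edges on its envelope.
  have hupper : ∀ f, (E.filter (good f)).card ≤ 3 * (S f).card := fun f =>
    card_adjacent_le (hc.mono (by exact_mod_cast hSI f)) _ fun e he => by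
      obtain ⟨h1, h2, h3, h4⟩ := Finset.mem_filter.1 he
      exact ⟨h2, h3, (hE e h1).2.2.1, h4⟩
  have hsize : (∑ f : I → Fin q, ((S f).card : ℝ)) = I.card * ((q : ℝ) ^ I.card / q) := by
    have h1 : ∀ f, ((S f).card : ℝ) = ∑ l : I, if f l = 0 then (1 : ℝ) else 0 := by
      intro f
      rw [Finset.card_image_of_injective _ Subtype.val_injective, Finset.sum_boole]
    simp_rw [h1]
    rw [Finset.sum_comm]
    have h2 : ∀ l : I, (∑ f : I → Fin q, if f l = 0 then (1 : ℝ) else 0) =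
        (q : ℝ) ^ I.card / q := by
      intro l
      rw [Finset.sum_boole]
      have h3 := card_colorings (I := I) (q := q) fun l' => if l' = l then {0} else Finset.univ
      have h4 : (Finset.univ.filter fun f : I → Fin q =>
          ∀ l', f l' ∈ (if l' = l then {0} else Finset.univ : Finset (Fin q))) =
          Finset.univ.filter fun f : I → Fin q => f l = 0 := by
        ext f
        simp only [Finset.mem_filter, Finset.mem_univ, true_and]
        constructor
        · intro h; simpa using h l
        · intro h l'
          by_cases hl : l' = l
          · subst hl; simp [h]
          · simp [hl]
      rw [h4] at h3
      rw [h3]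
      have h5 : ∀ l' : I, (((if l' = l then {0} else Finset.univ : Finset (Fin q)).card : ℕ) : ℝ) =
          q * if l' = l then (1 / q : ℝ) else 1 := by
        intro l'
        split_ifs <;> simp [hq0.ne']
      simp_rw [h5]
      rw [Finset.prod_mul_distrib, Finset.prod_ite_eq' Finset.univ l]
      simp [div_eq_mul_inv]
    simp_rw [h2]
    simp
  -- Every low tie is an edge of the envelope for many colourings.
  have hlower : ∀ e ∈ E, (q : ℝ) ^ I.card / (2 * q ^ 2) ≤
      ((Finset.univ.filter fun f : I → Fin q => good f e).card : ℝ) := by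
    intro e he
    obtain ⟨h1, h2, h3, p, hp1, hp2, hp3⟩ := hE e he
    set near : Finset I := Finset.univ.filter fun l => ev (c l) p < ev (c e.1) p with hnear
    have hnearcard : near.card ≤ k := by
      refine le_trans (le_of_eq ?_) hp3
      rw [← Finset.card_image_of_injective near Subtype.val_injective]
      congr 1
      ext l
      simp only [hnear, Finset.mem_image, Finset.mem_filter, Finset.mem_univ, true_and,
        Subtype.exists, exists_and_right, exists_eq_right]
      constructor
      · rintro ⟨a, b⟩; exact ⟨a, b⟩
      · rintro ⟨a, b⟩; exact ⟨a, b⟩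
    set s : I → Finset (Fin q) := fun l => if (l : ι) = e.1 ∨ (l : ι) = e.2 then {0} else
      if l ∈ near then Finset.univ.erase 0 else Finset.univ with hs
    have hsub : (Finset.univ.filter fun f : I → Fin q => ∀ l, f l ∈ s l) ⊆
        Finset.univ.filter fun f : I → Fin q => good f e := by
      intro f hf
      simp only [Finset.mem_filter, Finset.mem_univ, true_and] at hf ⊢
      have hf1 : f ⟨e.1, h1⟩ = 0 := by simpa [hs] using hf ⟨e.1, h1⟩
      have hf2 : f ⟨e.2, h2⟩ = 0 := by simpa [hs] using hf ⟨e.2, h2⟩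
      refine ⟨(hmemS f ⟨e.1, h1⟩).2 hf1, (hmemS f ⟨e.2, h2⟩).2 hf2, p, hp1, ?_⟩
      intro l hl hl1 hl2
      have hlI := hSI f hl
      have hl0 := (hmemS f ⟨l, hlI⟩).1 hl
      refine lt_of_le_of_ne ?_ (hp2 l hlI hl1 hl2).symm
      by_contra! hlt
      have := hf ⟨l, hlI⟩
      simp [hs, hl1, hl2, hnear, hlt, hl0] at this
    have hcount := card_colorings s
    refine le_trans ?_ (Nat.cast_le.2 (Finset.card_le_card hsub))
    rw [hcount]
    set w : I → ℝ := fun l => (if l = ⟨e.1, h1⟩ then (1 / q : ℝ) else 1) *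
      (if l = ⟨e.2, h2⟩ then (1 / q : ℝ) else 1) * (if l ∈ near then (1 - 1 / q : ℝ) else 1) with hw
    have hq1 : (1 / q : ℝ) ≤ 1 := by
      rw [div_le_one hq0]
      exact_mod_cast (by omega : 1 ≤ q)
    have hq1' : (0 : ℝ) ≤ 1 / q := by positivity
    have hws : ∀ l ∈ Finset.univ, (q : ℝ) * w l ≤ ((s l).card : ℝ) := by
      intro l _
      have hle : (q : ℝ) * (1 / q) = 1 := by field_simp
      have hcase : ∀ x : ℝ, x ≤ 1 → (q : ℝ) * ((1 / q) * x) ≤ 1 := by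
        intro x hx
        rw [← mul_assoc, hle]; linarith
      have hx3 : (if l ∈ near then (1 - 1 / q : ℝ) else 1) ≤ 1 := by split_ifs <;> linarith
      have hx3' : (0 : ℝ) ≤ (if l ∈ near then (1 - 1 / q : ℝ) else 1) := by split_ifs <;> linarith
      have hx2 : (if l = ⟨e.2, h2⟩ then (1 / q : ℝ) else 1) ≤ 1 := by split_ifs <;> linarith
      have hx2' : (0 : ℝ) ≤ (if l = ⟨e.2, h2⟩ then (1 / q : ℝ) else 1) := by
        split_ifs <;> linarith
      by_cases hl1 : l = ⟨e.1, h1⟩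
      · have : s l = {0} := by simp [hs, hl1]
        rw [this, hw]
        simp only [hl1, if_true, Finset.card_singleton, Nat.cast_one]
        rw [hl1] at hx3 hx3' hx2 hx2'
        rw [mul_assoc]
        exact hcase _ (mul_le_one₀ hx2 hx3' hx3)
      · by_cases hl2 : l = ⟨e.2, h2⟩
        · have : s l = {0} := by simp [hs, hl2]
          rw [this, hw]
          simp only [hl1, if_false, one_mul]
          simp only [hl2, if_true, Finset.card_singleton, Nat.cast_one]
          rw [hl2] at hx3
          exact hcase _ hx3
        · have hl1' : ¬ (l : ι) = e.1 := fun h => hl1 (Subtype.ext h)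
          have hl2' : ¬ (l : ι) = e.2 := fun h => hl2 (Subtype.ext h)
          simp only [hw, hs, hl1, hl2, hl1', hl2', if_false, or_self, one_mul]
          split_ifs with hn
          · rw [Finset.card_erase_of_mem (Finset.mem_univ _), Finset.card_univ, Fintype.card_fin,
              Nat.cast_sub (by omega)]
            simp only [Nat.cast_one, mul_sub, hle, mul_one]
            exact le_rfl
          · simp
    have hw0 : ∀ l ∈ Finset.univ, (0 : ℝ) ≤ (q : ℝ) * w l := by
      intro l _
      simp only [hw]
      refine mul_nonneg hq0.le (mul_nonneg (mul_nonneg ?_ ?_) ?_) <;> split_ifs <;> linarith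
    refine le_trans ?_ (Finset.prod_le_prod hw0 hws)
    simp only [hw]
    rw [Finset.prod_mul_distrib, Finset.prod_mul_distrib, Finset.prod_mul_distrib,
      Finset.prod_ite_eq' Finset.univ, Finset.prod_ite_eq' Finset.univ, Finset.prod_ite_mem,
      Finset.univ_inter, Finset.prod_const, Finset.prod_const]
    simp only [Finset.mem_univ, if_true, Finset.card_univ, Fintype.card_coe]
    have hbern : (1 / 2 : ℝ) ≤ (1 - 1 / q) ^ near.card := by
      have hpow : (1 - 1 / q : ℝ) ^ k ≤ (1 - 1 / q : ℝ) ^ near.card :=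
        pow_le_pow_of_le_one (by linarith) (by linarith) hnearcard
      have hb := one_add_mul_le_pow (a := (-(1 / q) : ℝ)) (by linarith) k
      have hk : (k : ℝ) * (1 / q) ≤ 1 / 2 := by
        rw [mul_one_div, div_le_div_iff₀ hq0 (by norm_num), hq]
        push_cast
        linarith
      calc (1 / 2 : ℝ) ≤ 1 + k * (-(1 / q)) := by linarith
        _ ≤ (1 + -(1 / q)) ^ k := hb
        _ = (1 - 1 / q) ^ k := by rw [sub_eq_add_neg]
        _ ≤ _ := hpow
    calc (q : ℝ) ^ I.card / (2 * q ^ 2) = (q : ℝ) ^ I.card * (1 / q * (1 / q) * (1 / 2)) := by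
          field_simp
      _ ≤ _ := by gcongr
  have hdouble : (∑ e ∈ E, ((Finset.univ.filter fun f : I → Fin q => good f e).card : ℝ)) =
      ∑ f : I → Fin q, ((E.filter (good f)).card : ℝ) := by
    exact_mod_cast Finset.sum_card_bipartiteAbove_eq_sum_card_bipartiteBelow
      (s := E) (t := (Finset.univ : Finset (I → Fin q))) (fun e f => good f e)
  have h1 : (E.card : ℝ) * ((q : ℝ) ^ I.card / (2 * q ^ 2)) ≤
      3 * (I.card * ((q : ℝ) ^ I.card / q)) := by
    calc (E.card : ℝ) * ((q : ℝ) ^ I.card / (2 * q ^ 2))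
        = ∑ e ∈ E, (q : ℝ) ^ I.card / (2 * q ^ 2) := by simp
      _ ≤ ∑ e ∈ E, ((Finset.univ.filter fun f : I → Fin q => good f e).card : ℝ) :=
          Finset.sum_le_sum hlower
      _ = ∑ f : I → Fin q, ((E.filter (good f)).card : ℝ) := hdouble
      _ ≤ ∑ f : I → Fin q, 3 * ((S f).card : ℝ) := Finset.sum_le_sum fun f _ => by
          exact_mod_cast hupper f
      _ = 3 * (I.card * ((q : ℝ) ^ I.card / q)) := by rw [← Finset.mul_sum, hsize]
  have h2 : (E.card : ℝ) ≤ 6 * q * I.card := by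
    have hpos : (0 : ℝ) < (q : ℝ) ^ I.card / (2 * q ^ 2) := by positivity
    refine le_of_mul_le_mul_right (h1.trans (le_of_eq ?_)) hpos
    field_simp
    ring
  have h3 : E.card ≤ 6 * q * I.card := by exact_mod_cast h2
  calc E.card ≤ 6 * q * I.card := h3
    _ = 12 * (k + 1) * I.card := by rw [hq]; ring

/-- The pairs of functions that are tied, apart from all the others, at a point with at most `k`
smaller functions are covered by `O(k n)` pairs. -/
theorem exists_cover_lowTie {I : Finset ι} {c : ι → ℝ × ℝ × ℝ}
    (hc : Set.InjOn (fun i => ((c i).1, (c i).2.1)) I) (k : ℕ) :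
    ∃ E : Finset (ι × ι), E.card ≤ 12 * (k + 1) * I.card ∧ (∀ e ∈ E, e.1 ∈ I ∧ e.2 ∈ I) ∧
      ∀ i ∈ I, ∀ j ∈ I, i ≠ j → (∃ p, LowTie I c k i j p) → (i, j) ∈ E ∨ (j, i) ∈ E := by
  classical
  obtain ⟨s, hs⟩ := exists_shear_injOn I c hc
  refine ⟨(I ×ˢ I).filter fun e => (shear s (c e.1)).1 < (shear s (c e.2)).1 ∧
    ∃ p, LowTie I c k e.1 e.2 p, ?_, ?_, ?_⟩
  · refine card_lowTie_le_of_injOn (c := fun i => shear s (c i)) hs k _ fun e he => ?_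
    obtain ⟨h1, h2, p, hp⟩ := Finset.mem_filter.1 he
    refine ⟨(Finset.mem_product.1 h1).1, (Finset.mem_product.1 h1).2, h2,
      (p.1, p.2 - s * p.1), ?_⟩
    simp only [LowTie, ev_shear]
    exact hp
  · intro e he
    exact Finset.mem_product.1 (Finset.mem_filter.1 he).1
  · rintro i hi j hj hij ⟨p, hp⟩
    rcases lt_trichotomy (shear s (c i)).1 (shear s (c j)).1 with h | h | h
    · exact Or.inl (Finset.mem_filter.2 ⟨Finset.mem_product.2 ⟨hi, hj⟩, h, p, hp⟩)
    · exact (hij (hs hi hj h)).elim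
    · exact Or.inr (Finset.mem_filter.2 ⟨Finset.mem_product.2 ⟨hj, hi⟩, h, p, hp.symm⟩)

end LowLevelTies

/-! ### Order of the smallest functions along a segment -/

section Kinetic

variable {ι : Type*}

/-- At `p` no two functions of the family take the same value. -/
def NoTies (I : Finset ι) (c : ι → ℝ × ℝ × ℝ) (p : ℝ × ℝ) : Prop :=
  ∀ i ∈ I, ∀ j ∈ I, i ≠ j → ev (c i) p ≠ ev (c j) p

open scoped Classical in
/-- Move along a segment without triple ties. The first time at which one of the `k + 1` smallest
functions is overtaken, at most `k` functions are smaller, so the overtaking is a low tie. -/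
lemma order_preserved_of_segment {I : Finset ι} {c : ι → ℝ × ℝ × ℝ} {k : ℕ} {E : Finset (ι × ι)}
    (hE : ∀ i ∈ I, ∀ j ∈ I, i ≠ j → (∃ p, LowTie I c k i j p) → (i, j) ∈ E ∨ (j, i) ∈ E)
    {p q : ℝ × ℝ} (hp : NoTies I c p) (hq : NoTies I c q)
    (hpq : ∀ e ∈ E, ev (c e.1) p < ev (c e.2) p ↔ ev (c e.1) q < ev (c e.2) q)
    (htriple : ∀ i ∈ I, ∀ j ∈ I, ∀ l ∈ I, i ≠ j → i ≠ l → j ≠ l → ∀ s : ℝ,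
      ev (c i) (p + s • (q - p)) = ev (c j) (p + s • (q - p)) →
      ev (c i) (p + s • (q - p)) ≠ ev (c l) (p + s • (q - p)))
    {i j : ι} (hi : i ∈ I) (hj : j ∈ I)
    (hik : (I.filter fun l => ev (c l) p < ev (c i) p).card ≤ k)
    (hij : ev (c i) p < ev (c j) p) : ev (c i) q < ev (c j) q := by
  by_contra hcon
  have hne : ∀ {x y : ι} {r : ℝ × ℝ}, ev (c x) r < ev (c y) r → x ≠ y := by
    rintro x y r h rfl; exact lt_irrefl _ h
  -- The pairs that change their order, and the times at which they do.
  set B := (I ×ˢ I).filter fun e => (I.filter fun l => ev (c l) p < ev (c e.1) p).card ≤ k ∧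
    ev (c e.1) p < ev (c e.2) p ∧ ev (c e.2) q < ev (c e.1) q with hB
  set T : ι × ι → ℝ := fun e => (ev (c e.2) p - ev (c e.1) p) /
    ((ev (c e.2) p - ev (c e.1) p) + (ev (c e.1) q - ev (c e.2) q)) with hT
  have hBne : B.Nonempty := ⟨(i, j), Finset.mem_filter.2 ⟨Finset.mem_product.2 ⟨hi, hj⟩, hik, hij,
    lt_of_le_of_ne (not_lt.1 hcon) (hq j hj i hi (hne hij).symm)⟩⟩
  obtain ⟨⟨a, b⟩, hab, hmin⟩ := Finset.exists_min_image B T hBne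
  obtain ⟨habI, hak, hlt, hgt⟩ := Finset.mem_filter.1 hab
  obtain ⟨ha, hb⟩ := Finset.mem_product.1 habI
  simp only at ha hb hak hlt hgt
  have hden : 0 < (ev (c b) p - ev (c a) p) + (ev (c a) q - ev (c b) q) := by linarith
  set s := T (a, b) with hs
  have hsmul : s * ((ev (c b) p - ev (c a) p) + (ev (c a) q - ev (c b) q)) =
      ev (c b) p - ev (c a) p := by
    rw [hs, hT]
    simp only
    rw [div_mul_cancel₀ _ hden.ne']
  have hs0 : 0 < s := by rw [hs, hT]; exact div_pos (by linarith) hden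
  have hs1 : s < 1 := by rw [hs, hT]; exact (div_lt_one hden).2 (by linarith)
  have htie : ev (c a) (p + s • (q - p)) = ev (c b) (p + s • (q - p)) := by
    rw [ev_line, ev_line]; linarith
  have hlow : LowTie I c k a b (p + s • (q - p)) := by
    refine ⟨htie, fun l hl hla hlb h => htriple a ha b hb l hl (hne hlt) hla.symm hlb.symm s htie
      h.symm, le_trans (Finset.card_le_card ?_) hak⟩
    intro l hl
    obtain ⟨hlI, hl⟩ := Finset.mem_filter.1 hl
    refine Finset.mem_filter.2 ⟨hlI, ?_⟩
    by_contra hnot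
    have hal : a ≠ l := (hne hl).symm
    have hlp : ev (c a) p < ev (c l) p := lt_of_le_of_ne (not_lt.1 hnot) (hp a ha l hlI hal)
    rw [ev_line, ev_line] at hl
    have hlq : ev (c l) q < ev (c a) q := by
      by_contra hle
      nlinarith
    have hden' : 0 < (ev (c l) p - ev (c a) p) + (ev (c a) q - ev (c l) q) := by linarith
    have hle := hmin (a, l) (Finset.mem_filter.2 ⟨Finset.mem_product.2 ⟨ha, hlI⟩, hak, hlp, hlq⟩)
    have hlt' : T (a, l) < s := by
      rw [hT]
      simp only
      rw [div_lt_iff₀ hden']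
      linarith
    exact absurd hle (not_le.2 hlt')
  rcases hE a ha b hb (hne hlt) ⟨_, hlow⟩ with h | h
  · exact absurd ((hpq _ h).1 hlt) (not_lt.2 hgt.le)
  · exact absurd ((hpq _ h).2 hgt) (not_lt.2 hlt.le)

open scoped Classical in
/-- Between points without ties that lie on the same side of the line of every low tie, the `k + 1`
smallest functions keep their places in the order. The hypothesis `hcol` says that the lines on which
`c i` ties with `c j` and with `c l` are different; it makes triple ties isolated, so that a segment
can avoid them. -/
theorem order_preserved {I : Finset ι} {c : ι → ℝ × ℝ × ℝ} {k : ℕ} {E : Finset (ι × ι)}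
    (hcol : ∀ i ∈ I, ∀ j ∈ I, ∀ l ∈ I, i ≠ j → i ≠ l → j ≠ l → ∀ r t : ℝ, r ≠ 0 → t ≠ 0 →
      r • (c i - c j) ≠ t • (c i - c l))
    (hEI : ∀ e ∈ E, e.1 ∈ I ∧ e.2 ∈ I)
    (hE : ∀ i ∈ I, ∀ j ∈ I, i ≠ j → (∃ p, LowTie I c k i j p) → (i, j) ∈ E ∨ (j, i) ∈ E)
    {p q : ℝ × ℝ} (hp : NoTies I c p) (hq : NoTies I c q)
    (hpq : ∀ e ∈ E, ev (c e.1) p < ev (c e.2) p ↔ ev (c e.1) q < ev (c e.2) q)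
    {i j : ι} (hi : i ∈ I) (hj : j ∈ I)
    (hik : (I.filter fun l => ev (c l) p < ev (c i) p).card ≤ k)
    (hij : ev (c i) p < ev (c j) p) : ev (c i) q < ev (c j) q := by
  -- A nearby endpoint `r`, with the same order, that avoids triple ties on the way from `p`.
  have hU : ∀ᶠ r in nhds q, ∀ x ∈ I, ∀ y ∈ I, ev (c x) q < ev (c y) q →
      ev (c x) r < ev (c y) r := by
    rw [Filter.eventually_all_finset]
    intro x _
    rw [Filter.eventually_all_finset]
    intro y _
    by_cases hxy : ev (c x) q < ev (c y) q
    · filter_upwards [(continuous_ev (c x)).continuousAt.eventually_lt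
        (continuous_ev (c y)).continuousAt hxy] with r hr _ using hr
    · exact Filter.Eventually.of_forall fun r h => (hxy h).elim
  obtain ⟨U, hUsub, hUo, hqU⟩ := eventually_nhds_iff.1 hU
  let w : ι × ι × ι → ℝ × ℝ × ℝ := fun z =>
    ev (c z.1 - c z.2.2) p • (c z.1 - c z.2.1) - ev (c z.1 - c z.2.1) p • (c z.1 - c z.2.2)
  set D := (I ×ˢ I ×ˢ I).filter fun z => z.1 ≠ z.2.1 ∧ z.1 ≠ z.2.2 ∧ z.2.1 ≠ z.2.2 with hD
  have hw : ∀ v ∈ D.image w, v ≠ 0 := by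
    intro v hv
    obtain ⟨z, hz, rfl⟩ := Finset.mem_image.1 hv
    obtain ⟨h1, h2, h3, h4⟩ := Finset.mem_filter.1 hz
    simp only [Finset.mem_product] at h1
    refine sub_ne_zero.2 (hcol _ h1.1 _ h1.2.1 _ h1.2.2 h2 h3 h4 _ _ ?_ ?_)
    · rw [ev_sub, sub_ne_zero]; exact hp _ h1.1 _ h1.2.2 h3
    · rw [ev_sub, sub_ne_zero]; exact hp _ h1.1 _ h1.2.1 h2
  obtain ⟨r, hrU, hr⟩ := exists_forall_ev_ne_zero _ hw hUo ⟨q, hqU⟩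
  have hord : ∀ x ∈ I, ∀ y ∈ I, ev (c x) q < ev (c y) q ↔ ev (c x) r < ev (c y) r := by
    intro x hx y hy
    refine ⟨hUsub r hrU x hx y hy, fun h => ?_⟩
    have hxy : x ≠ y := by rintro rfl; exact lt_irrefl _ h
    rcases lt_or_gt_of_ne (hq x hx y hy hxy) with h' | h'
    · exact h'
    · exact absurd (hUsub r hrU y hy x hx h') (not_lt.2 h.le)
  have hrN : NoTies I c r := by
    intro x hx y hy hxy
    rcases lt_or_gt_of_ne (hq x hx y hy hxy) with h' | h'
    · exact ((hord x hx y hy).1 h').ne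
    · exact ((hord y hy x hx).1 h').ne'
  rw [hord i hi j hj]
  refine order_preserved_of_segment hE hp hrN (fun e he => (hpq e he).trans
    (hord _ (hEI e he).1 _ (hEI e he).2)) ?_ hi hj hik hij
  intro x hx y hy l hl hxy hxl hyl s h1 h2
  refine hr (w (x, y, l)) (Finset.mem_image_of_mem _ (Finset.mem_filter.2
    ⟨by simp [hx, hy, hl], hxy, hxl, hyl⟩)) ?_
  simp only [w, ev_sub, ev_smul]
  rw [ev_line, ev_line] at h1 h2
  have hs : s ≠ 0 := by
    rintro rfl
    refine hp x hx y hy hxy ?_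
    simpa using h1
  have : s * ((ev (c x) p - ev (c l) p) * (ev (c x) r - ev (c y) r) -
      (ev (c x) p - ev (c y) p) * (ev (c x) r - ev (c l) r)) = 0 := by
    linear_combination (ev (c x) p - ev (c l) p) * h1 - (ev (c x) p - ev (c y) p) * h2
  exact (mul_eq_zero.1 this).resolve_left hs

end Kinetic

/-! ### Sign vectors of affine functions -/

section SignVectors

variable {κ : Type*}

/-- Three affine functions on the plane miss one of the eight sign patterns. -/
lemma exists_missing_sign_pattern (c : κ → ℝ × ℝ × ℝ) (s : Finset κ) (hs : s.card = 3) :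
    ∃ u ⊆ s, ∀ p, ∃ l ∈ s, ¬ (0 < ev (c l) p ↔ l ∈ u) := by
  classical
  have hdep : ∃ g : κ → ℝ, (∑ l ∈ s, g l * (c l).1 = 0) ∧ (∑ l ∈ s, g l * (c l).2.1 = 0) ∧
      ∃ l ∈ s, g l ≠ 0 := by
    have h : Module.finrank ℝ (ℝ × ℝ) < Fintype.card s := by
      simp [hs]
    have hnot : ¬ LinearIndependent ℝ fun l : s => ((c l).1, (c l).2.1) := fun hli => by
      have := hli.fintype_card_le_finrank
      omega
    obtain ⟨g, hg, i, hi⟩ := Fintype.not_linearIndependent_iff.1 hnot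
    refine ⟨fun l => if h : l ∈ s then g ⟨l, h⟩ else 0, ?_, ?_, i, i.2, by simpa using hi⟩
    · have := congrArg Prod.fst hg
      rw [← Finset.sum_coe_sort s]
      simpa [Prod.fst_sum] using this
    · have := congrArg Prod.snd hg
      rw [← Finset.sum_coe_sort s]
      simpa [Prod.snd_sum] using this
  -- A combination `∑ g l * ev (c l)` that is a nonnegative constant, with a negative coefficient if
  -- the constant vanishes.
  have hcomb : ∃ (g : κ → ℝ) (K : ℝ), (∀ p, ∑ l ∈ s, g l * ev (c l) p = K) ∧ 0 ≤ K ∧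
      (K = 0 → ∃ l ∈ s, g l < 0) := by
    obtain ⟨g, h1, h2, l, hl, hgl⟩ := hdep
    set K := ∑ l ∈ s, g l * (c l).2.2 with hK
    have hsum : ∀ p, ∑ l ∈ s, g l * ev (c l) p = K := by
      intro p
      have : ∑ l ∈ s, g l * ev (c l) p = (∑ l ∈ s, g l * (c l).1) * p.1 +
          (∑ l ∈ s, g l * (c l).2.1) * p.2 + K := by
        rw [hK, Finset.sum_mul, Finset.sum_mul, ← Finset.sum_add_distrib, ← Finset.sum_add_distrib]
        refine Finset.sum_congr rfl fun l _ => ?_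
        simp only [ev]; ring
      rw [this, h1, h2]; ring
    have hneg : ∀ p, ∑ l ∈ s, (-g l) * ev (c l) p = -K := by
      intro p
      rw [← hsum p, ← Finset.sum_neg_distrib]
      exact Finset.sum_congr rfl fun l _ => by ring
    rcases lt_trichotomy K 0 with h | h | h
    · exact ⟨fun l => -g l, -K, hneg, by linarith, fun h' => by linarith⟩
    · rcases lt_or_gt_of_ne hgl with h' | h'
      · exact ⟨g, K, hsum, h.ge, fun _ => ⟨l, hl, h'⟩⟩
      · exact ⟨fun l => -g l, -K, hneg, by linarith, fun _ => ⟨l, hl, by simpa using h'⟩⟩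
    · exact ⟨g, K, hsum, h.le, fun h' => by linarith⟩
  obtain ⟨g, K, hsum, hK0, hKneg⟩ := hcomb
  refine ⟨s.filter fun l => g l < 0, Finset.filter_subset _ _, fun p => ?_⟩
  by_contra! hall
  have hterm : ∀ l ∈ s, g l * ev (c l) p ≤ 0 := by
    intro l hl
    have := hall l hl
    by_cases hg : g l < 0
    · exact mul_nonpos_of_nonpos_of_nonneg hg.le (this.2 (Finset.mem_filter.2 ⟨hl, hg⟩)).le
    · refine mul_nonpos_of_nonneg_of_nonpos (not_lt.1 hg) (not_lt.1 fun h => hg ?_)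
      exact (Finset.mem_filter.1 (this.1 h)).2
  have hle : K ≤ 0 := hsum p ▸ Finset.sum_nonpos hterm
  obtain ⟨l, hl, hgl⟩ := hKneg (le_antisymm hle hK0)
  have hlt : ∑ l ∈ s, g l * ev (c l) p < 0 :=
    Finset.sum_neg' hterm ⟨l, hl, mul_neg_of_neg_of_pos hgl
      ((hall l hl).2 (Finset.mem_filter.2 ⟨hl, hgl⟩))⟩
  rw [hsum p] at hlt
  linarith

open scoped Classical in
/-- The sign vectors of `N` affine functions on the plane form a set family of VC dimension at most
two, so by the Sauer–Shelah lemma there are `O(N²)` of them. -/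
theorem card_signVectors_le [Fintype κ] (c : κ → ℝ × ℝ × ℝ) (V : Finset (Finset κ))
    (hV : ∀ v ∈ V, ∃ p, v = Finset.univ.filter fun l => 0 < ev (c l) p) :
    V.card ≤ 1 + Fintype.card κ + Fintype.card κ ^ 2 := by
  have hvc : V.vcDim ≤ 2 := by
    refine Finset.sup_le fun s hs => ?_
    by_contra! hlt
    obtain ⟨t, hts, ht⟩ := Finset.exists_subset_card_eq (show 3 ≤ s.card from hlt)
    obtain ⟨u, hut, hu⟩ := exists_missing_sign_pattern c t ht
    have hsh : V.Shatters t := (Finset.mem_shatterer.1 hs).mono_right hts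
    obtain ⟨v, hv, hvu⟩ := hsh hut
    obtain ⟨p, rfl⟩ := hV v hv
    obtain ⟨l, hl, hl'⟩ := hu p
    refine hl' ?_
    rw [← hvu]
    simp [hl]
  have h1 := (Finset.card_le_card_shatterer V).trans Finset.card_shatterer_le_sum_vcDim
  refine h1.trans ((Finset.sum_le_sum_of_subset (Finset.Iic_subset_Iic.2 hvc)).trans ?_)
  have h2 : Finset.Iic 2 = {0, 1, 2} := by decide
  rw [h2]
  rw [Finset.sum_insert (by simp), Finset.sum_insert (by simp), Finset.sum_singleton,
    Nat.choose_zero_right, Nat.choose_one_right]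
  have h3 := Nat.choose_le_pow (Fintype.card κ) 2
  omega

end SignVectors

/-! ### Elements reached by saturated matchings -/

section Saturated

variable {β α : Type*}

/-- A matching `π` such that everything that some `b` prefers to `π b` is matched. The preferences
of `b` are given by `d b`, smaller values being better. -/
def Saturated (d : β → α → ℝ) (π : β ↪ α) : Prop :=
  ∀ b x, d b x < d b (π b) → x ∈ Set.range π

open scoped Classical in
lemma sum_inv_card_le_harmonic (s : Finset β) (φ : β → ℝ) :
    ∑ b ∈ s, ((s.filter fun b' => φ b ≤ φ b').card : ℝ)⁻¹ ≤ (harmonic s.card : ℝ) := by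
  induction s using Finset.induction_on_min_value φ with
  | empty => simp
  | insert a s ha hmin ih =>
    rw [Finset.sum_insert ha, Finset.card_insert_of_notMem ha, harmonic_succ]
    push_cast
    rw [add_comm]
    refine add_le_add ((Finset.sum_le_sum fun b hb => ?_).trans ih) (le_of_eq ?_)
    · have hpos : 0 < (s.filter fun b' => φ b ≤ φ b').card :=
        Finset.card_pos.2 ⟨b, Finset.mem_filter.2 ⟨hb, le_rfl⟩⟩
      have hle : (s.filter fun b' => φ b ≤ φ b').card ≤
          ((insert a s).filter fun b' => φ b ≤ φ b').card :=
        Finset.card_le_card (Finset.filter_subset_filter _ (Finset.subset_insert _ _))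
      exact inv_anti₀ (by exact_mod_cast hpos) (by exact_mod_cast hle)
    · have : (insert a s).filter (fun b' => φ a ≤ φ b') = insert a s := by
        refine Finset.filter_true_of_mem fun b hb => ?_
        rcases Finset.mem_insert.1 hb with rfl | hb
        · exact le_rfl
        · exact hmin b hb
      rw [this, Finset.card_insert_of_notMem ha]
      push_cast
      rfl

open scoped Classical in
/-- The elements that occur in the range of a saturated matching. -/
noncomputable def reachable [Fintype α] (d : β → α → ℝ) : Finset α :=
  Finset.univ.filter fun a => ∃ π, Saturated d π ∧ a ∈ Set.range π

lemma mem_reachable [Fintype α] {d : β → α → ℝ} {a : α} :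
    a ∈ reachable d ↔ ∃ π, Saturated d π ∧ a ∈ Set.range π := by
  simp [reachable]

variable [Fintype β] [Fintype α]

open scoped Classical in
/-- The ranges of saturated matchings `τ b` cover at most `m H_m` elements. If `d b (τ c b)` is at
most `d b (τ c' b)` then `τ c b` lies in the range of `τ c'`. So the ranges overlap: for fixed `b`,
ordering the values `d b (τ c b)`, the `j`-th largest one belongs to an element that is covered at
least `j` times. -/
lemma card_union_range_le (d : β → α → ℝ) (hd : ∀ b, Function.Injective (d b)) (τ : β → (β ↪ α))
    (hτ : ∀ b, Saturated d (τ b)) :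
    ((Finset.univ.filter fun a : α => ∃ b, a ∈ Set.range (τ b)).card : ℝ) ≤
      Fintype.card β * (harmonic (Fintype.card β) : ℝ) := by
  set mult : α → ℕ := fun a => (Finset.univ.filter fun b => a ∈ Set.range (τ b)).card with hmult
  have hmem : ∀ b c c', d b (τ c b) ≤ d b (τ c' b) → τ c b ∈ Set.range (τ c') := by
    intro b c c' h
    rcases h.eq_or_lt with h | h
    · exact ⟨b, (hd b h).symm⟩
    · exact hτ c' b _ h
  calc ((Finset.univ.filter fun a : α => ∃ b, a ∈ Set.range (τ b)).card : ℝ)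
      = ∑ a ∈ Finset.univ.filter (fun a : α => ∃ b, a ∈ Set.range (τ b)), (1 : ℝ) := by simp
    _ = ∑ a ∈ Finset.univ.filter (fun a : α => ∃ b, a ∈ Set.range (τ b)),
          ∑ b : β, if a ∈ Set.range (τ b) then ((mult a : ℝ))⁻¹ else 0 := by
        refine Finset.sum_congr rfl fun a ha => ?_
        obtain ⟨b, hb⟩ := (Finset.mem_filter.1 ha).2
        have hpos : 0 < mult a := Finset.card_pos.2 ⟨b, Finset.mem_filter.2 ⟨by simp, hb⟩⟩
        rw [← Finset.sum_filter, Finset.sum_const, nsmul_eq_mul]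
        exact (mul_inv_cancel₀ (by exact_mod_cast hpos.ne')).symm
    _ ≤ ∑ a : α, ∑ b : β, if a ∈ Set.range (τ b) then ((mult a : ℝ))⁻¹ else 0 :=
        Finset.sum_le_sum_of_subset_of_nonneg (Finset.filter_subset _ _) fun a _ _ =>
          Finset.sum_nonneg fun b _ => by split_ifs <;> positivity
    _ = ∑ c : β, ∑ a : α, if a ∈ Set.range (τ c) then ((mult a : ℝ))⁻¹ else 0 :=
        Finset.sum_comm
    _ = ∑ c : β, ∑ b : β, ((mult (τ c b) : ℝ))⁻¹ := by
        refine Finset.sum_congr rfl fun c _ => ?_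
        rw [← Finset.sum_filter]
        have : (Finset.univ.filter fun a => a ∈ Set.range (τ c)) = Finset.univ.map (τ c) := by
          ext a; simp
        rw [this, Finset.sum_map]
    _ = ∑ b : β, ∑ c : β, ((mult (τ c b) : ℝ))⁻¹ := Finset.sum_comm
    _ ≤ ∑ b : β, (harmonic (Fintype.card β) : ℝ) := by
        refine Finset.sum_le_sum fun b _ => ?_
        refine (Finset.sum_le_sum fun c _ => ?_).trans
          (sum_inv_card_le_harmonic Finset.univ fun c => d b (τ c b))
        refine inv_anti₀ ?_ ?_
        · refine Nat.cast_pos.2 (Finset.card_pos.2 ⟨c, ?_⟩)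
          simp
        · refine Nat.cast_le.2 (Finset.card_le_card fun c' hc' => ?_)
          exact Finset.mem_filter.2 ⟨by simp, hmem b c c' (Finset.mem_filter.1 hc').2⟩
    _ = Fintype.card β * (harmonic (Fintype.card β) : ℝ) := by simp

open scoped Classical in
/-- The saturated matchings of `m` elements use at most `m H_m` elements altogether: they are
covered by the matchings in which some `b` is worst off. -/
theorem card_reachable_le (d : β → α → ℝ) (hd : ∀ b, Function.Injective (d b)) :
    ((reachable d).card : ℝ) ≤
      Fintype.card β * (harmonic (Fintype.card β) : ℝ) := by
  by_cases hne : ∃ π, Saturated d π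
  · obtain ⟨π₀, hπ₀⟩ := hne
    have hmax : ∀ b, ∃ τ, Saturated d τ ∧ ∀ π, Saturated d π → d b (π b) ≤ d b (τ b) := by
      intro b
      obtain ⟨τ, hτ, h⟩ := Finset.exists_max_image
        (Finset.univ.filter fun π : β ↪ α => Saturated d π) (fun π => d b (π b))
        ⟨π₀, by simpa using hπ₀⟩
      exact ⟨τ, (Finset.mem_filter.1 hτ).2, fun π hπ => h π (by simpa using hπ)⟩
    choose τ hτ hτmax using hmax
    refine le_trans (Nat.cast_le.2 (Finset.card_le_card ?_)) (card_union_range_le d hd τ hτ)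
    intro a ha
    obtain ⟨π, hπ, b, rfl⟩ := mem_reachable.1 ha
    refine Finset.mem_filter.2 ⟨by simp, b, ?_⟩
    rcases (hτmax b π hπ).eq_or_lt with h | h
    · exact ⟨b, (hd b h).symm⟩
    · exact hτ b b _ h
  · have : reachable d = ∅ := Finset.eq_empty_of_forall_notMem fun a ha => by
      obtain ⟨π, hπ, -⟩ := mem_reachable.1 ha
      exact hne ⟨π, hπ⟩
    rw [this, Finset.card_empty, Nat.cast_zero]
    have : (0 : ℝ) ≤ (harmonic (Fintype.card β) : ℝ) := by
      exact_mod_cast Finset.sum_nonneg fun i _ => by positivity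
    positivity

end Saturated

end PlanarEnvelope

namespace PartialMatching

open PlanarEnvelope

/-! ### The partial-matching subdivision -/

/-- The coefficients of the affine function `t ↦ ‖b + t - a‖² - ‖t‖²`. -/
noncomputable def distCoeff (b a : Plane) : ℝ × ℝ × ℝ :=
  (2 * (b 0 - a 0), 2 * (b 1 - a 1), ‖b - a‖ ^ 2)

lemma norm_sq_eq (x : Plane) : ‖x‖ ^ 2 = x 0 ^ 2 + x 1 ^ 2 := by
  rw [EuclideanSpace.norm_sq_eq, Fin.sum_univ_two]
  simp

lemma norm_sq_eq_ev (b a t : Plane) :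
    ‖b + t - a‖ ^ 2 = ‖t‖ ^ 2 + ev (distCoeff b a) (t 0, t 1) := by
  simp only [ev, distCoeff, norm_sq_eq, PiLp.add_apply, PiLp.sub_apply]
  ring

lemma plane_ext {x y : Plane} (h0 : x 0 = y 0) (h1 : x 1 = y 1) : x = y := by
  ext i
  fin_cases i
  · exact h0
  · exact h1

lemma distCoeff_gradient_injective (b : Plane) :
    Function.Injective fun a => ((distCoeff b a).1, (distCoeff b a).2.1) := by
  intro x y h
  simp only [distCoeff, Prod.mk.injEq] at h
  exact plane_ext (by linarith [h.1]) (by linarith [h.2])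

/-- The perpendicular bisectors of two sides of a triangle are different lines. -/
lemma distCoeff_bisectors_ne (b : Plane) {a x y : Plane} (hax : a ≠ x) (hxy : x ≠ y)
    {r t : ℝ} (hr : r ≠ 0) :
    r • (distCoeff b a - distCoeff b x) ≠ t • (distCoeff b a - distCoeff b y) := by
  intro h
  have h0 := congrArg Prod.fst h
  have h1 := congrArg (fun z : ℝ × ℝ × ℝ => z.2.1) h
  have h2 := congrArg (fun z : ℝ × ℝ × ℝ => z.2.2) h
  simp only [distCoeff, norm_sq_eq, PiLp.sub_apply, Prod.smul_fst, Prod.smul_snd, Prod.fst_sub,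
    Prod.snd_sub, smul_eq_mul] at h0 h1 h2
  have hpos : 0 < (x 0 - a 0) ^ 2 + (x 1 - a 1) ^ 2 := by
    by_contra hle
    refine hax (plane_ext ?_ ?_) <;>
      nlinarith [sq_nonneg (x 0 - a 0), sq_nonneg (x 1 - a 1)]
  have e0 : r * (x 0 - a 0) = t * (y 0 - a 0) := by linarith
  have e1 : r * (x 1 - a 1) = t * (y 1 - a 1) := by linarith
  have e2 : r * ((x 0 - a 0) ^ 2 + (x 1 - a 1) ^ 2) = t * ((y 0 - a 0) ^ 2 + (y 1 - a 1) ^ 2) := by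
    linear_combination (-1) * h2 + 2 * (b 0 - a 0) * e0 + 2 * (b 1 - a 1) * e1
  have e3 : r * ((x 0 - a 0) ^ 2 + (x 1 - a 1) ^ 2) * (r - t) = 0 := by
    linear_combination (r * (x 0 - a 0) + t * (y 0 - a 0)) * e0 +
      (r * (x 1 - a 1) + t * (y 1 - a 1)) * e1 - t * e2
  have hrt : r = t := by
    have := (mul_eq_zero.1 e3).resolve_left (mul_ne_zero hr hpos.ne')
    linarith
  rw [← hrt] at e0 e1
  have e0' := mul_left_cancel₀ hr e0
  have e1' := mul_left_cancel₀ hr e1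
  exact hxy (plane_ext (by linarith) (by linarith))

variable (B A : Finset Plane)

/-- The coefficients of the affine function `t ↦ cost B A π t - |B| * ‖t‖²`. -/
noncomputable def costCoeff (π : B ↪ A) : ℝ × ℝ × ℝ := ∑ b : B, distCoeff b (π b)

lemma cost_eq (π : B ↪ A) (t : Plane) :
    cost B A π t = B.card * ‖t‖ ^ 2 + ev (costCoeff B A π) (t 0, t 1) := by
  simp only [cost, norm_sq_eq_ev, Finset.sum_add_distrib, costCoeff, ev_sum]
  simp

open scoped Classical in
/-- The cost functions, up to their common quadratic part. -/
noncomputable def costFunctions : Finset (ℝ × ℝ × ℝ) := Finset.univ.image (costCoeff B A)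

lemma optimal_eq (t : Plane) :
    optimal B A t = {π | costCoeff B A π ∈ active (costFunctions B A) id (t 0, t 1)} := by
  classical
  ext π
  simp [optimal, cost_eq, mem_active, costFunctions]

variable {B A}

/-- All assignments with the same image that are optimal somewhere have the same cost function,
since the gradient of the cost depends on the image only. -/
lemma costCoeff_eq_of_image_eq {π σ : B ↪ A} {p q : ℝ × ℝ}
    (hπ : ev (costCoeff B A π) p ≤ ev (costCoeff B A σ) p)
    (hσ : ev (costCoeff B A σ) q ≤ ev (costCoeff B A π) q)
    (h : Finset.univ.map π = Finset.univ.map σ) : costCoeff B A π = costCoeff B A σ := by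
  have hsum : ∀ f : A → ℝ, ∑ b, f (π b) = ∑ b, f (σ b) := by
    intro f
    have := congrArg (fun s => ∑ a ∈ s, f a) h
    simpa only [Finset.sum_map] using this
  have h0 : (costCoeff B A π).1 = (costCoeff B A σ).1 := by
    simp only [costCoeff, Prod.fst_sum, distCoeff]
    rw [← Finset.mul_sum, ← Finset.mul_sum, Finset.sum_sub_distrib, Finset.sum_sub_distrib,
      hsum fun a => (a : Plane) 0]
  have h1 : (costCoeff B A π).2.1 = (costCoeff B A σ).2.1 := by
    simp only [costCoeff, Prod.fst_sum, Prod.snd_sum, distCoeff]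
    rw [← Finset.mul_sum, ← Finset.mul_sum, Finset.sum_sub_distrib, Finset.sum_sub_distrib,
      hsum fun a => (a : Plane) 1]
  simp only [ev, h0, h1] at hπ hσ
  exact Prod.ext h0 (Prod.ext h1 (by linarith))

/-- In an assignment of minimum cost, a point of `A` closer to `b + t` than the one assigned to `b`
is assigned as well: otherwise `b` could move to it. -/
lemma saturated_of_minimal {π : B ↪ A} {p : ℝ × ℝ}
    (hπ : ∀ σ, ev (costCoeff B A π) p ≤ ev (costCoeff B A σ) p) :
    Saturated (fun (b : B) (a : A) => ev (distCoeff b a) p) π := by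
  classical
  intro b x hx
  by_contra hxr
  refine absurd (hπ (π.setValue b x)) (not_le.2 ?_)
  simp only [costCoeff, ev_sum]
  refine Finset.sum_lt_sum (fun b' _ => ?_) ⟨b, Finset.mem_univ _, ?_⟩
  · by_cases hb : b' = b
    · subst hb
      rw [Function.Embedding.setValue_eq]
      exact hx.le
    · rw [Function.Embedding.setValue_eq_of_ne hb fun h => hxr ⟨b', h⟩]
  · rw [Function.Embedding.setValue_eq]
    exact hx

lemma isOpen_strictMin (Φ : Finset (ℝ × ℝ × ℝ)) (c : ℝ × ℝ × ℝ) :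
    IsOpen {p | StrictMin Φ id c p} := by
  have : {p | StrictMin Φ id c p} = ⋂ d ∈ Φ, {p | d ≠ c → ev c p < ev d p} := by
    ext p; simp [StrictMin]
  rw [this]
  refine isOpen_biInter_finset fun d _ => ?_
  by_cases h : d = c
  · simp [h]
  · simpa [h] using isOpen_lt (continuous_ev c) (continuous_ev d)

lemma exists_generic_strictMin {c : ℝ × ℝ × ℝ} (hc : c ∈ regionFunctions (costFunctions B A)) :
    ∃ p, StrictMin (costFunctions B A) id c p ∧ ∀ b ∈ B, NoTies A (distCoeff b) p := by
  classical
  obtain ⟨q, hq⟩ := (Finset.mem_filter.1 hc).2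
  set D := (B ×ˢ A ×ˢ A).filter fun z => z.2.1 ≠ z.2.2
  obtain ⟨p, hp, hpD⟩ := exists_forall_ev_ne_zero
    (D.image fun z => distCoeff z.1 z.2.1 - distCoeff z.1 z.2.2) (by
      intro v hv
      obtain ⟨z, hz, rfl⟩ := Finset.mem_image.1 hv
      refine sub_ne_zero.2 fun h => (Finset.mem_filter.1 hz).2 ?_
      exact distCoeff_gradient_injective z.1 (by simp only [h]))
    (isOpen_strictMin (costFunctions B A) c) ⟨q, hq⟩
  refine ⟨p, hp, fun b hb i hi j hj hij h => hpD (distCoeff b i - distCoeff b j) ?_ ?_⟩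
  · exact Finset.mem_image.2 ⟨(b, i, j), Finset.mem_filter.2 ⟨by simp [hb, hi, hj], hij⟩, rfl⟩
  · rw [ev_sub, h, sub_self]

/-- The number of regions: within a cell of the arrangement of the low bisectors, all optimal
assignments have their images in a common set of at most `m H_m` points. -/
theorem card_regionFunctions_le :
    (regionFunctions (costFunctions B A)).card ≤
      (⌊(B.card : ℝ) * (harmonic B.card : ℝ)⌋₊).choose B.card *
        (1 + 12 * B.card ^ 2 * A.card + (12 * B.card ^ 2 * A.card) ^ 2) := by
  classical
  set m := B.card with hm
  choose E hEcard hEA hE using fun b : B => exists_cover_lowTie (I := A) (c := distCoeff b)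
    ((distCoeff_gradient_injective b).injOn) (m - 1)
  set K := Finset.univ.sigma E with hK
  let line : K → ℝ × ℝ × ℝ := fun z => distCoeff z.1.1 z.1.2.2 - distCoeff z.1.1 z.1.2.1
  have hKcard : Fintype.card K ≤ 12 * m ^ 2 * A.card := by
    rw [Fintype.card_coe, hK, Finset.card_sigma]
    refine (Finset.sum_le_sum fun b _ => hEcard b).trans ?_
    rw [Finset.sum_const, Finset.card_univ, Fintype.card_coe, smul_eq_mul, ← hm]
    rcases Nat.eq_zero_or_pos m with h | h
    · simp [h]
    · rw [Nat.sub_add_cancel h]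
      exact le_of_eq (by ring)
  have hP : ∀ c, ∃ p, c ∈ regionFunctions (costFunctions B A) →
      StrictMin (costFunctions B A) id c p ∧ ∀ b ∈ B, NoTies A (distCoeff b) p := by
    intro c
    by_cases hc : c ∈ regionFunctions (costFunctions B A)
    · obtain ⟨p, hp⟩ := exists_generic_strictMin hc
      exact ⟨p, fun _ => hp⟩
    · exact ⟨0, fun h => (hc h).elim⟩
  choose P hP using hP
  have hasgn : ∀ c : regionFunctions (costFunctions B A), ∃ π, costCoeff B A π = c := fun c => by
    obtain ⟨π, -, hπ⟩ := Finset.mem_image.1 (Finset.mem_filter.1 c.2).1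
    exact ⟨π, hπ⟩
  choose asg hasgn using hasgn
  have hmin : ∀ (c : regionFunctions (costFunctions B A)) (σ : B ↪ A),
      ev (costCoeff B A (asg c)) (P c) ≤ ev (costCoeff B A σ) (P c) := by
    intro c σ
    rw [hasgn]
    by_cases h : costCoeff B A σ = c
    · rw [h]
    · exact ((hP c c.2).1 _ (Finset.mem_image_of_mem _ (Finset.mem_univ σ)) h).le
  let d : ℝ × ℝ → B → A → ℝ := fun p b a => ev (distCoeff b a) p
  let sgn : regionFunctions (costFunctions B A) → Finset K := fun c =>
    Finset.univ.filter fun l => 0 < ev (line l) (P c)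
  -- An assignment that is optimal in the cell of `P c₀` is saturated at `P c₀`.
  have hsat : ∀ c c₀, sgn c = sgn c₀ → Saturated (d (P c₀)) (asg c) := by
    intro c c₀ hcc b x hx
    by_contra hxr
    have hsat_c := saturated_of_minimal (hmin c)
    have hxne : (asg c b : Plane) ≠ x := fun h => hxr ⟨b, Subtype.ext h⟩
    have hlt : ev (distCoeff b (asg c b)) (P c) < ev (distCoeff b x) (P c) :=
      lt_of_le_of_ne (not_lt.1 fun h => hxr (hsat_c b x h))
        ((hP c c.2).2 b b.2 _ (asg c b).2 _ x.2 hxne)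
    refine absurd hx (not_lt.2 (le_of_lt ?_))
    refine order_preserved (E := E b) (k := m - 1) ?_ (hEA b) (hE b) ((hP c c.2).2 b b.2)
      ((hP c₀ c₀.2).2 b b.2) ?_ (asg c b).2 x.2 ?_ hlt
    · intro i _ j _ l _ hij _ hjl r t hr _
      exact distCoeff_bisectors_ne b hij hjl hr
    · intro e he
      have := Finset.ext_iff.1 hcc ⟨⟨b, e⟩, Finset.mem_sigma.2 ⟨Finset.mem_univ _, he⟩⟩
      simpa [sgn, line, ev_sub] using this
    · -- The points preferred to `asg c b` are assigned to the other elements of `B`.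
      have hsub : (A.filter fun l => ev (distCoeff b l) (P c) < ev (distCoeff b (asg c b)) (P c)) ⊆
          ((Finset.univ.erase b).image fun b' => (asg c b' : Plane)) := by
        intro l hl
        obtain ⟨hlA, hl⟩ := Finset.mem_filter.1 hl
        obtain ⟨b', hb'⟩ := hsat_c b ⟨l, hlA⟩ hl
        refine Finset.mem_image.2 ⟨b', Finset.mem_erase.2 ⟨?_, Finset.mem_univ _⟩, by rw [hb']⟩
        rintro rfl
        rw [hb'] at hl
        exact lt_irrefl _ hl
      refine (Finset.card_le_card hsub).trans (Finset.card_image_le.trans ?_)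
      rw [Finset.card_erase_of_mem (Finset.mem_univ _), Finset.card_univ, Fintype.card_coe]
  have hfiber : ∀ v ∈ Finset.univ.image sgn, (Finset.univ.filter fun c => sgn c = v).card ≤
      (⌊(m : ℝ) * (harmonic m : ℝ)⌋₊).choose m := by
    intro v hv
    obtain ⟨c₀, -, rfl⟩ := Finset.mem_image.1 hv
    have hRcard : (reachable (d (P c₀))).card ≤ ⌊(m : ℝ) * (harmonic m : ℝ)⌋₊ := by
      refine Nat.le_floor ?_
      have := card_reachable_le (d (P c₀)) fun b i j hij => by
        by_contra hne
        exact (hP c₀ c₀.2).2 b b.2 _ i.2 _ j.2 (fun h => hne (Subtype.ext h)) hij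
      rwa [Fintype.card_coe] at this
    refine le_trans ?_ (Nat.choose_le_choose m hRcard)
    rw [← Finset.card_powersetCard]
    refine Finset.card_le_card_of_injOn (fun c => Finset.univ.map (asg c)) ?_ ?_
    · intro c hc
      have hc' := (Finset.mem_filter.1 hc).2
      refine Finset.mem_coe.2 (Finset.mem_powersetCard.2 ⟨?_, by simp [hm]⟩)
      intro a ha
      obtain ⟨b, -, rfl⟩ := Finset.mem_map.1 ha
      exact mem_reachable.2 ⟨asg c, hsat c c₀ hc', b, rfl⟩
    · intro c _ c' _ h
      apply Subtype.ext
      rw [← hasgn c, ← hasgn c']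
      exact costCoeff_eq_of_image_eq (hmin c (asg c')) (hmin c' (asg c)) h
  have h1 := Finset.card_le_mul_card_image (f := sgn) Finset.univ _ hfiber
  rw [Finset.card_univ, Fintype.card_coe] at h1
  refine h1.trans (Nat.mul_le_mul_left _ ?_)
  refine (card_signVectors_le line _ fun v hv => ?_).trans ?_
  · obtain ⟨c, -, rfl⟩ := Finset.mem_image.1 hv
    exact ⟨P c, rfl⟩
  · gcongr

/-! ### Counting faces -/

lemma faces_finite_and_ncard_le (hne : Nonempty (B ↪ A)) : (faces B A).Finite ∧
    (faces B A).ncard ≤ 6 * (regionFunctions (costFunctions B A)).card := by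
  classical
  set Φ := costFunctions B A with hΦ
  set F := Φ.powerset.filter fun f => ∃ p, f = active Φ id p with hF
  have hsub : faces B A ⊆ ((F.image fun f => {s : Plane | optimal B A s =
      {π | costCoeff B A π ∈ f}} : Finset (Set Plane)) : Set (Set Plane)) := by
    rintro _ ⟨t, rfl⟩
    refine Finset.mem_coe.2 (Finset.mem_image.2 ⟨active Φ id (t 0, t 1),
      Finset.mem_filter.2 ⟨Finset.mem_powerset.2 fun i hi => (mem_active.1 hi).1, _, rfl⟩, ?_⟩)
    simp only [optimal_eq B A t]
    rfl
  refine ⟨(Finset.finite_toSet _).subset hsub, ?_⟩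
  refine (Set.ncard_le_ncard hsub (Finset.finite_toSet _)).trans ?_
  rw [Set.ncard_coe_finset]
  refine Finset.card_image_le.trans (card_faces_le ?_ F fun f hf => (Finset.mem_filter.1 hf).2)
  obtain ⟨π⟩ := hne
  exact ⟨_, Finset.mem_image_of_mem _ (Finset.mem_univ π)⟩

lemma complexity_le_ncard_faces (h : (faces B A).Finite) :
    complexity B A ≤ (faces B A).ncard := by
  have hsub : ∀ k, facesOfDim B A k ⊆ faces B A := fun k => Set.sep_subset _ _
  have hdisj : ∀ k l, k ≠ l → Disjoint (facesOfDim B A k) (facesOfDim B A l) := by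
    intro k l hkl
    rw [Set.disjoint_left]
    rintro s ⟨-, h1⟩ ⟨-, h2⟩
    exact hkl (h1.symm.trans h2)
  rw [complexity, ← Set.ncard_union_eq (hdisj 0 1 (by norm_num)) (h.subset (hsub 0))
    (h.subset (hsub 1)), ← Set.ncard_union_eq (Set.disjoint_union_left.2
      ⟨hdisj 0 2 (by norm_num), hdisj 1 2 (by norm_num)⟩)
      ((h.subset (hsub 0)).union (h.subset (hsub 1))) (h.subset (hsub 2))]
  exact Set.ncard_le_ncard (Set.union_subset (Set.union_subset (hsub 0) (hsub 1)) (hsub 2)) h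

/-- Stirling's formula turns `m!` in the denominator into `√m (m / e)^m`; the factor `√m` is what
lowers the exponent of `m` from `4` to `3.5`. -/
lemma choose_harmonic_le {m : ℕ} (hm : 1 ≤ m) :
    ((⌊(m : ℝ) * (harmonic m : ℝ)⌋₊.choose m : ℕ) : ℝ) ≤
      (Real.exp 1 * Real.log m + Real.exp 1) ^ m / √m := by
  have hm0 : (0 : ℝ) < m := by exact_mod_cast hm
  have hH0 : (0 : ℝ) ≤ (harmonic m : ℝ) := by
    exact_mod_cast Finset.sum_nonneg fun i _ => by positivity
  have hH := harmonic_le_one_add_log m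
  have hsqrt : √(m : ℝ) ≤ √(2 * Real.pi * m) := by
    refine Real.sqrt_le_sqrt ?_
    nlinarith [Real.pi_gt_three]
  have hst : √(m : ℝ) * (m / Real.exp 1) ^ m ≤ (m.factorial : ℝ) :=
    le_trans (by gcongr) (Stirling.le_factorial_stirling m)
  calc ((⌊(m : ℝ) * (harmonic m : ℝ)⌋₊.choose m : ℕ) : ℝ)
      ≤ (⌊(m : ℝ) * (harmonic m : ℝ)⌋₊ : ℝ) ^ m / (m.factorial : ℝ) := Nat.choose_le_pow_div _ _
    _ ≤ (m * (1 + Real.log m)) ^ m / (√(m : ℝ) * (m / Real.exp 1) ^ m) := by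
        have : (⌊(m : ℝ) * (harmonic m : ℝ)⌋₊ : ℝ) ≤ m * (1 + Real.log m) :=
          (Nat.floor_le (by positivity)).trans (by gcongr)
        gcongr
    _ = (Real.exp 1 * Real.log m + Real.exp 1) ^ m / √m := by
        rw [div_pow, mul_pow, show Real.exp 1 * Real.log m + Real.exp 1 =
          Real.exp 1 * (1 + Real.log m) by ring, mul_pow]
        field_simp

end PartialMatching

theorem theorem3p3 :
    ∃ C : ℝ, 0 < C ∧ ∀ (A B : Finset Plane) (n m : ℕ),
      A.card = n → B.card = m → 1 ≤ m → m ≤ n →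
        (PartialMatching.faces B A).Finite ∧
        (PartialMatching.complexity B A : ℝ) ≤
          C * ((n : ℝ) ^ 2 * (m : ℝ) ^ (3.5 : ℝ) *
            (Real.exp 1 * Real.log (m : ℝ) + Real.exp 1) ^ m) := by
  refine ⟨2592, by norm_num, ?_⟩
  rintro A B n m rfl rfl hm hmn
  have hemb : Nonempty (B ↪ A) := Function.Embedding.nonempty_of_card_le (by simpa using hmn)
  obtain ⟨hfin, hcard⟩ := PartialMatching.faces_finite_and_ncard_le hemb
  refine ⟨hfin, ?_⟩
  set n := A.card
  set m := B.card
  have h1 : PartialMatching.complexity B A ≤ 6 * ((⌊(m : ℝ) * (harmonic m : ℝ)⌋₊).choose m *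
      (1 + 12 * m ^ 2 * n + (12 * m ^ 2 * n) ^ 2)) :=
    (PartialMatching.complexity_le_ncard_faces hfin).trans (hcard.trans
      (Nat.mul_le_mul_left _ PartialMatching.card_regionFunctions_le))
  -- Here `12 * m ^ 2 * n` bounds the number of low bisectors and `6 = 1 + 3 + 2` counts regions,
  -- edges and vertices, so that `2592 = 6 * 3 * 12 ^ 2`.
  have h2 : 1 + 12 * m ^ 2 * n + (12 * m ^ 2 * n) ^ 2 ≤ 3 * (12 * m ^ 2 * n) ^ 2 := by
    have : 1 ≤ 12 * m ^ 2 * n := Nat.mul_pos (by positivity) (hm.trans hmn)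
    nlinarith
  have h3 : (PartialMatching.complexity B A : ℝ) ≤
      6 * (((⌊(m : ℝ) * (harmonic m : ℝ)⌋₊).choose m : ℕ) * (3 * (12 * m ^ 2 * n) ^ 2)) := by
    exact_mod_cast h1.trans (Nat.mul_le_mul_left _ (Nat.mul_le_mul_left _ h2))
  have hm0 : (0 : ℝ) < m := by exact_mod_cast hm
  have hpow : (m : ℝ) ^ (3.5 : ℝ) = m ^ 4 / √m := by
    rw [Real.sqrt_eq_rpow, ← Real.rpow_natCast, ← Real.rpow_sub hm0]
    norm_num
  calc (PartialMatching.complexity B A : ℝ)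
      ≤ 6 * ((Real.exp 1 * Real.log m + Real.exp 1) ^ m / √m * (3 * (12 * m ^ 2 * n) ^ 2)) :=
        h3.trans (by gcongr; exact PartialMatching.choose_harmonic_le hm)
    _ = 2592 * ((n : ℝ) ^ 2 * (m : ℝ) ^ (3.5 : ℝ) *
            (Real.exp 1 * Real.log (m : ℝ) + Real.exp 1) ^ m) := by
        rw [hpow]; ring
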